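/- Setting. Let $T=[0,\infty)$, let $Q$ be a finite set (of discrete modes), $Q^*$ the words over $Q$, $Q^{\le L}$ the words of length at most $L$, $\epsilon$ the empty word, $\mathcal U=\mathbb R^m$, $\mathcal Y=\mathbb R^p$. Let $PC(T,\mathcal U)$ be the piecewise-continuous maps $T\to\mathcal U$ (finitely many discontinuities on every $[0,t]$, with finite one-sided limits), and $(Q\times T)^+$ the non-empty finite sequences $(q_1,t_1)\cdots(q_k,t_k)$. An input-output map is a map $f:PC(T,\mathcal U)\times(Q\times T)^+\to\mathcal Y$; let $\Phi$ be a non-empty (possibly infinite) set of such maps. A linear switched system (LSS) $\Sigma$ of dimension $n\ge 0$ consists of matrices $A_q\in\mathbb R^{n\times n}$, $B_q\in\mathbb R^{n\times m}$, $C_q\in\mathbb R^{p\times n}$, $q\in Q$. The state $x_\Sigma(x_0,u,w)$, $w=(q_1,t_1)\cdots(q_k,t_k)$, is obtained from $x_0$ by following $\dot x(s)=A_{q_i}x(s)+B_{q_i}u(s+\sum_{j<i}t_j)$ for time $t_i$, successively for $i=1,\dots,k$, and $y_\Sigma(x_0,u,w)=C_{q_k}x_\Sigma(x_0,u,w)$.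 An LSS realization is a pair $(\Sigma,\mu)$ with $\mu:\Phi\to\mathbb R^n$. It is a realization of $\Phi$ if $y_\Sigma(\mu(f),u,w)=f(u,w)$ for all $f\in\Phi$, $u$, $w$; a minimal one if moreover no realization of $\Phi$ has smaller dimension; semi-reachable if the states $x_\Sigma(\mu(f),u,w)$ ($f\in\Phi$, $u\in PC(T,\mathcal U)$, $w\in(Q\times T)^+$) span $\mathbb R^n$; observable if distinct states $x_1\ne x_2$ always have $y_\Sigma(x_1,\cdot,\cdot)\neq y_\Sigma(x_2,\cdot,\cdot)$. $\Phi$ has a generalized kernel representation if there are analytic functions $K^f_w:T^{|w|}\to\mathbb R^p$ and $G_w:T^{|w|}\to\mathbb R^{p\times m}$ ($f\in\Phi$, $w$ a non-empty word) such that (i) $K^f_{wqqv}(\dots,t,\hat t,\dots)=K^f_{wqv}(\dots,t+\hat t,\dots)$ and likewise for $G$; (ii) $K^f_{vqw}(\dots,0,\dots)=K^f_{vw}(\dots)$ whenever $w\ne\epsilon$ (with $0$ in the place of $q$), and likewise for $G$ whenever $v,w\neq\epsilon$; (iii) $f(u,(q_1,t_1)\cdots(q_k,t_k))=K^f_{q_1\cdots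 q_k}(t_1,\dots,t_k)+\sum_{i=1}^k\int_0^{t_i}G_{q_i\cdots q_k}(t_i-s,t_{i+1},\dots,t_k)\,u(s+\sum_{j<i}t_j)\,ds$. The Markov parameters of such a $\Phi$ are, for $w=q_1\cdots q_k$, $k\ge 0$, with $f_{u,q_1\cdots q_k}(t_1,\dots,t_k)=f(u,(q_1,t_1)\cdots(q_k,t_k))$, \[S_{f,q}(w)=\tfrac{d}{dt_1}\cdots\tfrac{d}{dt_k}f_{0,q_1\cdots q_kq}(t_1,\dots,t_k,0)\big|_{0},\] \[S_{q,q_0,j}(w)=\tfrac{d}{dt_0}\cdots\tfrac{d}{dt_k}\bigl(f_{e_j,q_0q_1\cdots q_kq}-f_{0,q_0q_1\cdots q_kq}\bigr)(t_0,\dots,t_k,0)\big|_{0},\] where $e_j$ is the constant input equal to the $j$-th unit vector, and the second expression does not depend on $f\in\Phi$. $(\Sigma,\mu)$ is an $N$-partial realization of $\Phi$ if $S_{q,q_0,j}(q_1\cdots q_k)=C_qA_{q_k}\cdots A_{q_1}B_{q_0}e_j$ and $S_{f,q}(q_1\cdots q_k)=C_qA_{q_k}\cdots A_{q_1}\mu(f)$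 for all words of length $k\le N$ and all $q,q_0\in Q$, $1\le j\le m$, $f\in\Phi$. The Hankel matrix $H_\Phi$ has rows indexed by $(v,(q,r))\in Q^*\times(Q\times\{1,\dots,p\})$, columns indexed by $(w,j)$ with $w\in Q^*$ and $j\in J_\Phi=\Phi\sqcup(Q\times\{1,\dots,m\})$, and entries $(S_{f,q}(wv))_r$ if $j=f\in\Phi$ and $(S_{q,q_0,z}(wv))_r$ if $j=(q_0,z)$. $H_{\Phi,L,M}$ is the submatrix of rows with $|v|\le L$ and columns with $|w|\le M$. The rank (in $\mathbb N\cup\{\infty\}$) of a matrix is the dimension of the span of its columns. Algorithm 1, for $N\in\mathbb N$: let $n=\operatorname{rank}H_{\Phi,N,N+1}$, let $\mathcal M$ be a linear isomorphism from the column space of $H_{\Phi,N,N+1}$ to $\mathbb R^n$, and let $c_{w,j}$ be the columns of $H_{\Phi,N,N+1}$. Return $(\Sigma_N,\mu_N)$ of dimension $n$ such that, for all $q\in Q$: the $z$-th column of $B_q$ is $\mathcal M(c_{\epsilon,(q,z)})$; $C_q\mathcal M(c_{w,j})$ is the vector of the entries of $c_{w,j}$ in the rows $(\epsilon,(q,1)),\dots,(\epsilon,(q,p))$,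 for all $w\in Q^{\le N+1}$, $j\in J_\Phi$; $\mathcal M^{-1}A_q\mathcal M(c_{w,j})=c_{wq,j}$ for all $w\in Q^{\le N}$, $j\in J_\Phi$ (abort if there is no such $A_q$); and $\mu_N(f)=\mathcal M(c_{\epsilon,f})$ for $f\in\Phi$. Theorem. Let $\Phi$ be a non-empty family of input-output maps admitting a generalized kernel representation, and let $N\in\mathbb N$. 1. If \[\operatorname{rank}H_{\Phi,N,N}=\operatorname{rank}H_{\Phi,N+1,N}=\operatorname{rank}H_{\Phi,N,N+1},\tag{$*$}\] then, for every choice of $\mathcal M$, Algorithm 1 returns a (uniquely determined) realization $(\Sigma_N,\mu_N)$, and it is a semi-reachable and observable $(2N+1)$-partial realization of $\Phi$. 2. If $\operatorname{rank}H_{\Phi,N,N}=\operatorname{rank}H_\Phi$, then $(*)$ holds and $(\Sigma_N,\mu_N)$ is a minimal realization of $\Phi$. 3. If $\Phi$ has an LSS realization $(\Sigma,\mu)$ with $\dim\Sigma\le N+1$, then $\operatorname{rank}H_{\Phi,N,N}=\operatorname{rank}H_\Phi$. -/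

import Mathlib

open Set Filter Topology MeasureTheory
open scoped NNReal Matrix

noncomputable section

namespace SwitchedSystem

/-! The time axis `T = [0, ∞)` is `ℝ≥0`; the spaces `ℝⁿ` are `Fin n → ℝ`; `Q` is the set of
discrete modes, words over `Q` are `List Q`. -/

/-- Piecewise-continuous maps `T → ℝᵐ`: finitely many discontinuities on each `[0, t]`, and finite
one-sided limits at each of them. (At `s = 0` the left-hand condition is void, as `𝓝[<] 0 = ⊥`.) -/
def IsPiecewiseContinuous {m : ℕ} (u : ℝ≥0 → Fin m → ℝ) : Prop :=
  (∀ t : ℝ≥0, {s | s ≤ t ∧ ¬ ContinuousAt u s}.Finite) ∧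
  ∀ s, ¬ ContinuousAt u s →
    (∃ l, Tendsto u (𝓝[>] s) (𝓝 l)) ∧ (∃ l, Tendsto u (𝓝[<] s) (𝓝 l))

/-- The space `PC(T, ℝᵐ)` of continuous-valued inputs. -/
def PC (m : ℕ) : Type := {u : ℝ≥0 → Fin m → ℝ // IsPiecewiseContinuous u}

/-- The constant input with value `a`. -/
def PC.const {m : ℕ} (a : Fin m → ℝ) : PC m :=
  ⟨fun _ => a, by
    have h : ∀ s : ℝ≥0, ContinuousAt (fun _ : ℝ≥0 => a) s := fun s => continuousAt_const
    refine ⟨fun t => ?_, fun s hs => absurd (h s) hs⟩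
    simp [h]⟩

/-- The set `(Q × T)⁺` of non-empty switching sequences `(q₁,t₁)⋯(q_k,t_k)`. -/
abbrev SwitchSeq (Q : Type*) : Type _ := {w : List (Q × ℝ≥0) // w ≠ []}

/-- Input-output maps `PC(T, ℝᵐ) × (Q × T)⁺ → ℝᵖ`. -/
abbrev IOMap (Q : Type*) (m p : ℕ) : Type _ := PC m → SwitchSeq Q → Fin p → ℝ

/-! ### Linear switched systems -/

/-- A linear switched system `ẋ = A_q x + B_q u`, `y = C_q x` with state space `ℝⁿ`. -/
structure LSS (Q : Type*) (m p n : ℕ) where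
  A : Q → Matrix (Fin n) (Fin n) ℝ
  B : Q → Matrix (Fin n) (Fin m) ℝ
  C : Q → Matrix (Fin p) (Fin n) ℝ

/-- `x` solves `ẋ(s) = A x(s) + B v(s)` on `[0, ∞)` with `x(0) = x₀`: it is continuous and
satisfies the equation wherever the (piecewise-continuous) input `v` is continuous. -/
def IsSolution {n m : ℕ} (A : Matrix (Fin n) (Fin n) ℝ) (B : Matrix (Fin n) (Fin m) ℝ)
    (v : ℝ → Fin m → ℝ) (x₀ : Fin n → ℝ) (x : ℝ → Fin n → ℝ) : Prop :=
  ContinuousOn x (Ici 0) ∧ x 0 = x₀ ∧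
    ∀ s : ℝ, 0 < s → ContinuousAt v s → HasDerivAt x (A *ᵥ x s + B *ᵥ v s) s

/-- The solution of the initial value problem (on `[0, ∞)` it exists and is unique for every
piecewise-continuous `v`). -/
def solution {n m : ℕ} (A : Matrix (Fin n) (Fin n) ℝ) (B : Matrix (Fin n) (Fin m) ℝ)
    (v : ℝ → Fin m → ℝ) (x₀ : Fin n → ℝ) : ℝ → Fin n → ℝ :=
  Classical.epsilon (IsSolution A B v x₀)

namespace LSS

variable {Q : Type*} {m p n : ℕ}

/-- The state reached from `x₀`, started at time `τ` with the input `u`, after running through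
the given sequence of modes and dwell times. -/
def stateFrom (S : LSS Q m p n) (u : PC m) :
    ℝ≥0 → (Fin n → ℝ) → List (Q × ℝ≥0) → Fin n → ℝ
  | _, x₀, [] => x₀
  | τ, x₀, (q, t) :: w =>
      S.stateFrom u (τ + t)
        (solution (S.A q) (S.B q) (fun s => u.1 (s.toNNReal + τ)) x₀ (t : ℝ)) w

/-- The state `x_Σ(x₀, u, w)`. -/
def state (S : LSS Q m p n) (x₀ : Fin n → ℝ) (u : PC m) (w : SwitchSeq Q) : Fin n → ℝ :=
  S.stateFrom u 0 x₀ w.1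

/-- The output `y_Σ(x₀, u, w) = C_{q_k} x_Σ(x₀, u, w)`; as a function of `(u, w)` this is the
input-output map induced by `x₀`. -/
def output (S : LSS Q m p n) (x₀ : Fin n → ℝ) : IOMap Q m p :=
  fun u w => S.C (w.1.getLast w.2).1 *ᵥ S.state x₀ u w

/-- The set of states reachable from `X₀`. -/
def Reach (S : LSS Q m p n) (X₀ : Set (Fin n → ℝ)) : Set (Fin n → ℝ) :=
  {x | ∃ u : PC m, ∃ w : SwitchSeq Q, ∃ x₀ ∈ X₀, x = S.state x₀ u w}

/-- `S` is semi-reachable from `X₀`: the reachable set spans the state space. -/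
def SemiReachableFrom (S : LSS Q m p n) (X₀ : Set (Fin n → ℝ)) : Prop :=
  Submodule.span ℝ (S.Reach X₀) = ⊤

/-- `S` is observable: no two distinct states induce the same input-output map. -/
def Observable (S : LSS Q m p n) : Prop :=
  ∀ x₁ x₂ : Fin n → ℝ, (∀ u w, S.output x₁ u w = S.output x₂ u w) → x₁ = x₂

/-- `A_{q_k} ⋯ A_{q_1} x` for the word `q_1 ⋯ q_k`. -/
def runWord (S : LSS Q m p n) (w : List Q) (x : Fin n → ℝ) : Fin n → ℝ :=
  w.foldl (fun y q => S.A q *ᵥ y) x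

end LSS

/-- An LSS realization `(Σ, μ)` of dimension `n`, with `μ` assigning a state to each `f ∈ Φ`. -/
structure Realization {Q : Type*} {m p : ℕ} (Φ : Set (IOMap Q m p)) (n : ℕ) where
  sys : LSS Q m p n
  μ : Φ → Fin n → ℝ

/-! ### Markov parameters -/

section Markov

variable {Q : Type*} {m p : ℕ}

/-- For `w = q₁⋯q_k`, the iterated partial derivative
`d/dt₁ ⋯ d/dt_k g((q₁,t₁)⋯(q_k,t_k))` at `t₁ = ⋯ = t_k = 0`. The functions live on `T^k`, so
the derivatives are one-sided. -/
def mixedDeriv : (List (Q × ℝ≥0) → Fin p → ℝ) → List Q → Fin p → ℝ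
  | g, [] => g []
  | g, q :: w =>
      derivWithin (fun t : ℝ => mixedDeriv (fun l => g ((q, t.toNNReal) :: l)) w) (Ici 0) 0

/-- `d/dt₁ ⋯ d/dt_k f_{u, q₁⋯q_k q}(t₁, …, t_k, 0)` at `t₁ = ⋯ = t_k = 0`. -/
def ioDeriv (f : IOMap Q m p) (u : PC m) (w : List Q) (q : Q) : Fin p → ℝ :=
  mixedDeriv (fun l => f u ⟨l ++ [(q, 0)], by simp⟩) w

/-- The Markov parameter `S_{f,q}(w)`. -/
def markovState (f : IOMap Q m p) (q : Q) (w : List Q) : Fin p → ℝ :=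
  ioDeriv f (PC.const 0) w q

/-- The Markov parameter `S_{q,q₀,j}(w)`, computed from the member `f` of the family. For a family
with a generalized kernel representation it does not depend on the member. -/
def markovInput (f : IOMap Q m p) (q q₀ : Q) (j : Fin m) (w : List Q) : Fin p → ℝ :=
  ioDeriv f (PC.const (Pi.single j 1)) (q₀ :: w) q - ioDeriv f (PC.const 0) (q₀ :: w) q

end Markov

/-! ### Generalized kernel representations -/

/-- A function of switching sequences is analytic if for each word `q₁⋯q_k` it is an analytic
function of `(t₁, …, t_k)` on `T^k`. -/
def AnalyticInTimes {Q E : Type*} [NormedAddCommGroup E] [NormedSpace ℝ E]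
    (F : List (Q × ℝ≥0) → E) : Prop :=
  ∀ (k : ℕ) (q : Fin k → Q),
    AnalyticOn ℝ (fun t : Fin k → ℝ => F (List.ofFn fun i => (q i, (t i).toNNReal)))
      {t | ∀ i, 0 ≤ t i}

/-- `Φ` has a generalized kernel representation. The value `K_{q₁⋯q_k}(t₁,…,t_k)` is written
`K [(q₁,t₁),…,(q_k,t_k)]`, and similarly for `G`; values at the empty list play no role. -/
def HasGeneralizedKernelRepresentation {Q : Type*} {m p : ℕ} (Φ : Set (IOMap Q m p)) : Prop :=
  ∃ (K : Φ → List (Q × ℝ≥0) → Fin p → ℝ) (G : List (Q × ℝ≥0) → Matrix (Fin p) (Fin m) ℝ),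
    ((∀ f, AnalyticInTimes (K f)) ∧ ∀ i j, AnalyticInTimes (fun l => G l i j)) ∧
    (∀ (w v : List (Q × ℝ≥0)) (q : Q) (t t' : ℝ≥0),
      (∀ f, K f (w ++ (q, t) :: (q, t') :: v) = K f (w ++ (q, t + t') :: v)) ∧
      G (w ++ (q, t) :: (q, t') :: v) = G (w ++ (q, t + t') :: v)) ∧
    (∀ (v w : List (Q × ℝ≥0)) (q : Q), w ≠ [] →
      (∀ f, K f (v ++ (q, 0) :: w) = K f (v ++ w)) ∧
      (v ≠ [] → G (v ++ (q, 0) :: w) = G (v ++ w))) ∧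
    ∀ (f : Φ) (u : PC m) (w : SwitchSeq Q),
      f.1 u w = K f w.1 + ∑ i : Fin w.1.length,
        ∫ s in (0 : ℝ)..((w.1.get i).2 : ℝ),
          G (((w.1.get i).1, (((w.1.get i).2 : ℝ) - s).toNNReal) :: w.1.drop (i + 1)) *ᵥ
            u.1 (s.toNNReal + ((w.1.take i).map Prod.snd).sum)

/-! ### Hankel matrices -/

section Hankel

variable {Q : Type*} {m p : ℕ}

/-- The Hankel matrix `H_Φ`. Rows are indexed by `(v, (q, r))`, the pair `(q, r)` standing for
the `r`-th coordinate of the block belonging to the mode `q`; columns are indexed by `(w, j)`,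
`j ∈ Φ ∪ (Q × {1,…,m})`. The member `f₀` of `Φ` serves to compute the `S_{q,q₀,j}`. -/
def hankel (Φ : Set (IOMap Q m p)) (f₀ : Φ) :
    Matrix (List Q × (Q × Fin p)) (List Q × (Φ ⊕ (Q × Fin m))) ℝ :=
  fun vi wj =>
    match wj.2 with
    | Sum.inl f => markovState f.1 vi.2.1 (wj.1 ++ vi.1) vi.2.2
    | Sum.inr qz => markovInput f₀.1 vi.2.1 qz.1 qz.2 (wj.1 ++ vi.1) vi.2.2

/-- The words of length at most `L`. -/
abbrev WordLE (Q : Type*) (L : ℕ) : Type _ := {w : List Q // w.length ≤ L}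

/-- The submatrix `H_{Φ,L,M}`: rows with `|v| ≤ L`, columns with `|w| ≤ M`. -/
def subHankel (Φ : Set (IOMap Q m p)) (f₀ : Φ) (L M : ℕ) :
    Matrix (WordLE Q L × (Q × Fin p)) (WordLE Q M × (Φ ⊕ (Q × Fin m))) ℝ :=
  (hankel Φ f₀).submatrix (Prod.map Subtype.val id) (Prod.map Subtype.val id)

/-- The condition `rank H_{Φ,N,N} = rank H_{Φ,N+1,N} = rank H_{Φ,N,N+1}`. -/
def RankCondition (Φ : Set (IOMap Q m p)) (f₀ : Φ) (N : ℕ) : Prop :=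
  (subHankel Φ f₀ N N).eRank = (subHankel Φ f₀ (N + 1) N).eRank ∧
  (subHankel Φ f₀ (N + 1) N).eRank = (subHankel Φ f₀ N (N + 1)).eRank

/-- The column space of `H_{Φ,N,N+1}`. -/
abbrev colSpace (Φ : Set (IOMap Q m p)) (f₀ : Φ) (N : ℕ) :
    Submodule ℝ (WordLE Q N × (Q × Fin p) → ℝ) :=
  Submodule.span ℝ (range (subHankel Φ f₀ N (N + 1)).col)

/-- The column of `H_{Φ,N,N+1}` indexed by `(w, j)`, as an element of the column space. -/
def column (Φ : Set (IOMap Q m p)) (f₀ : Φ) (N : ℕ) (w : WordLE Q (N + 1))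
    (j : Φ ⊕ (Q × Fin m)) : colSpace Φ f₀ N :=
  ⟨(subHankel Φ f₀ N (N + 1)).col (w, j), Submodule.subset_span (mem_range_self _)⟩

end Hankel

/-! ### Realizations, partial realizations and the algorithm -/

namespace Realization

variable {Q : Type*} {m p : ℕ} {Φ : Set (IOMap Q m p)} {n : ℕ}

/-- `(Σ, μ)` is a realization of `Φ`. -/
def Realizes (R : Realization Φ n) : Prop :=
  ∀ (f : Φ) (u : PC m) (w : SwitchSeq Q), R.sys.output (R.μ f) u w = f.1 u w

/-- `(Σ, μ)` is a minimal realization of `Φ`. -/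
def IsMinimal (R : Realization Φ n) : Prop :=
  R.Realizes ∧ ∀ (n' : ℕ) (R' : Realization Φ n'), R'.Realizes → n ≤ n'

/-- `(Σ, μ)` is semi-reachable. -/
def SemiReachable (R : Realization Φ n) : Prop :=
  R.sys.SemiReachableFrom (range R.μ)

/-- `(Σ, μ)` is observable. -/
def Observable (R : Realization Φ n) : Prop :=
  R.sys.Observable

/-- `(Σ, μ)` is an `N`-partial realization of `Φ`. -/
def IsPartial (R : Realization Φ n) (N : ℕ) : Prop :=
  ∀ (f : Φ) (q : Q) (w : List Q), w.length ≤ N →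
    (∀ (q₀ : Q) (j : Fin m),
      markovInput f.1 q q₀ j w = R.sys.C q *ᵥ R.sys.runWord w ((R.sys.B q₀).col j)) ∧
    markovState f.1 q w = R.sys.C q *ᵥ R.sys.runWord w (R.μ f)

/-- `(Σ, μ)` is returned by the column-shift algorithm applied to `H_{Φ,N,N+1}` with the
isomorphism `iso` from the column space to `ℝⁿ`. The algorithm aborts iff there is no such
`(Σ, μ)`. -/
structure IsAlgorithmOutput (f₀ : Φ) (N : ℕ) (iso : colSpace Φ f₀ N ≃ₗ[ℝ] (Fin n → ℝ))
    (R : Realization Φ n) : Prop where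
  B_eq : ∀ (q : Q) (z : Fin m),
    (R.sys.B q).col z = iso (column Φ f₀ N ⟨[], by simp⟩ (Sum.inr (q, z)))
  C_eq : ∀ (q : Q) (w : WordLE Q (N + 1)) (j : Φ ⊕ (Q × Fin m)) (r : Fin p),
    (R.sys.C q *ᵥ iso (column Φ f₀ N w j)) r =
      subHankel Φ f₀ N (N + 1) (⟨[], by simp⟩, (q, r)) (w, j)
  A_eq : ∀ (q : Q) (w : WordLE Q N) (j : Φ ⊕ (Q × Fin m)),
    iso.symm (R.sys.A q *ᵥ iso (column Φ f₀ N ⟨w.1, by have := w.2; omega⟩ j)) =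
      column Φ f₀ N ⟨w.1 ++ [q], by simpa using w.2⟩ j
  μ_eq : ∀ f : Φ, R.μ f = iso (column Φ f₀ N ⟨[], by simp⟩ (Sum.inl f))

end Realization

end SwitchedSystem

end

/-!
Analyticity, the merging rule (i) and the zero rule (ii) make an input-output map with a kernel
representation determined by its Markov parameters, and for a linear switched system these are
`C_q A_w x` and `C_q A_w B_{q₀} e_j`.

Passing from the column `(w, j)` of the Hankel matrix to `(wq, j)` is the linear row shift
`(qv, i) ↦ (v, i)`. The rank condition says that the columns with `|w| ≤ N`, cut off at height `N`,
span the whole column space of `H_{Φ,N,N+1}` and already determine their entries at height `N + 1`;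
hence the shift descends to that space, which gives `A_q`. Reading `N + 1` letters through columns
and `N` through rows recovers the Markov parameters up to length `2N + 1`. If moreover `H_{Φ,N,N}`
has full rank, no column leaves the span and the recovery has no length limit.

A realization of dimension `n` factors the Hankel matrix through its state space, so that its rank
is at most `n`; the increasing chain of reachable spaces and the decreasing chain of unobservable
spaces stop within `n` steps, so words of length at most `N` suffice when `n ≤ N + 1`.
-/

noncomputable section

namespace SwitchedSystem

/-! ### One-sided calculus for analytic functions -/

section Calculus

variable {X E : Type*} [NormedAddCommGroup X] [NormedSpace ℝ X]
  [NormedAddCommGroup E] [NormedSpace ℝ E]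

theorem hasDerivWithinAt_partial_snd {H : X × ℝ → E} {s : Set X} {t : Set ℝ} {x : X} {τ : ℝ}
    (hH : DifferentiableWithinAt ℝ H (s ×ˢ t) (x, τ)) (hx : x ∈ s) :
    HasDerivWithinAt (fun σ => H (x, σ)) (fderivWithin ℝ H (s ×ˢ t) (x, τ) (0, 1)) t τ :=
  hH.hasFDerivWithinAt.comp_hasDerivWithinAt τ
    ((hasDerivWithinAt_const τ t x).prodMk (hasDerivWithinAt_id τ t)) fun _ hσ => ⟨hx, hσ⟩

theorem analyticOn_derivWithin_partial_snd {H : X × ℝ → E} {s : Set X} {t : Set ℝ} {τ : ℝ}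
    (hH : AnalyticOn ℝ H (s ×ˢ t)) (hs : UniqueDiffOn ℝ s) (ht : UniqueDiffOn ℝ t) (hτ : τ ∈ t) :
    AnalyticOn ℝ (fun x => derivWithin (fun σ => H (x, σ)) t τ) s := by
  have hfderiv : AnalyticOn ℝ (fun x => fderivWithin ℝ H (s ×ˢ t) (x, τ)) s :=
    (hH.fderivWithin (hs.prod ht)).comp (analyticOn_id.prod analyticOn_const)
      fun _ hx => ⟨hx, hτ⟩
  refine (((ContinuousLinearMap.apply ℝ E ((0 : X), (1 : ℝ))).analyticOn univ).comp hfderiv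
    (mapsTo_univ _ _)).congr fun x hx => ?_
  exact (hasDerivWithinAt_partial_snd (hH.differentiableOn _ ⟨hx, hτ⟩) hx).derivWithin (ht τ hτ)

theorem exists_lipschitzOnWith_of_analyticOn {H : X → E} {s t : Set X} (hH : AnalyticOn ℝ H s)
    (hs : UniqueDiffOn ℝ s) (ht : IsCompact t) (ht' : Convex ℝ t) (hts : t ⊆ s) :
    ∃ K, LipschitzOnWith K H t :=
  LocallyLipschitzOn.exists_lipschitzOnWith_of_compact ht fun x hx =>
    (((hH.contDiffOn (n := 1) hs).mono hts) x hx).exists_lipschitzOnWith ht'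

theorem hasDerivWithinAt_integral_of_lipschitz {F : ℝ → ℝ → E} {F' : ℝ → E} {a b C τ₀ : ℝ}
    {t : Set ℝ} (hint : ∀ τ ∈ t, IntervalIntegrable (F τ) volume a b) (hτ₀ : τ₀ ∈ t)
    (hlip : ∀ᶠ τ in 𝓝[t] τ₀, ∀ s ∈ uIoc a b, ‖F τ s - F τ₀ s‖ ≤ C * |τ - τ₀|)
    (hderiv : ∀ s ∈ uIoc a b, HasDerivWithinAt (F · s) (F' s) t τ₀) :
    HasDerivWithinAt (fun τ => ∫ s in a..b, F τ s) (∫ s in a..b, F' s) t τ₀ := by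
  rw [hasDerivWithinAt_iff_tendsto_slope]
  have hsub : ∀ τ ∈ t, IntervalIntegrable (fun s => slope (F · s) τ₀ τ) volume a b := fun τ hτ =>
    ((hint τ hτ).sub (hint τ₀ hτ₀)).smul (τ - τ₀)⁻¹
  have hmem : ∀ᶠ τ in 𝓝[t \ {τ₀}] τ₀, τ ∈ t \ {τ₀} := self_mem_nhdsWithin
  refine (intervalIntegral.tendsto_integral_filter_of_dominated_convergence (μ := volume)
    (F := fun τ s => slope (F · s) τ₀ τ) (fun _ => C) ?_ ?_ intervalIntegrable_const ?_).congr' ?_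
  · filter_upwards [hmem] with τ hτ using (hsub τ hτ.1).def'.aestronglyMeasurable
  · filter_upwards [hmem, hlip.filter_mono (nhdsWithin_mono _ sdiff_subset)] with τ hτ hτC
    refine Eventually.of_forall fun s hs => ?_
    rw [slope_def_module, norm_smul, norm_inv, Real.norm_eq_abs,
      inv_mul_le_iff₀ (abs_pos.2 (sub_ne_zero.2 hτ.2)), mul_comm]
    exact hτC s hs
  · exact Eventually.of_forall fun s hs => hasDerivWithinAt_iff_tendsto_slope.1 (hderiv s hs)
  · filter_upwards [hmem] with τ hτ
    simp only [slope_def_module]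
    rw [intervalIntegral.integral_smul,
      intervalIntegral.integral_sub (hint τ hτ.1) (hint τ₀ hτ₀)]

theorem hasDerivWithinAt_integral_of_analyticOn {H : ℝ × ℝ → E}
    (hH : AnalyticOn ℝ H (Ici 0 ×ˢ Ici 0)) {b : ℝ} (hb : 0 ≤ b) :
    HasDerivWithinAt (fun τ => ∫ s in (0 : ℝ)..b, H (s, τ))
      (∫ s in (0 : ℝ)..b, derivWithin (fun τ => H (s, τ)) (Ici 0) 0) (Ici 0) 0 := by
  obtain ⟨C, hC⟩ := exists_lipschitzOnWith_of_analyticOn (t := Icc 0 b ×ˢ Icc 0 1) hH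
    ((uniqueDiffOn_Ici 0).prod (uniqueDiffOn_Ici 0)) (isCompact_Icc.prod isCompact_Icc)
    ((convex_Icc 0 b).prod (convex_Icc 0 1)) (prod_mono Icc_subset_Ici_self Icc_subset_Ici_self)
  refine hasDerivWithinAt_integral_of_lipschitz (C := C) (fun τ hτ => ?_) self_mem_Ici ?_
    fun s hs => ?_
  · refine (hH.continuousOn.comp (f := fun s : ℝ => (s, τ)) (by fun_prop) ?_).intervalIntegrable
    rw [uIcc_of_le hb]
    exact fun s hs => ⟨hs.1, hτ⟩
  · filter_upwards [Icc_mem_nhdsGE (zero_lt_one' ℝ)] with τ hτ s hs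
    rw [uIoc_of_le hb] at hs
    have hs' : s ∈ Icc 0 b := Ioc_subset_Icc_self hs
    simpa [dist_eq_norm, Prod.norm_def] using
      hC.dist_le_mul (s, τ) ⟨hs', hτ⟩ (s, 0) ⟨hs', by simp⟩
  · rw [uIoc_of_le hb] at hs
    exact (hasDerivWithinAt_partial_snd (hH.differentiableOn (s, 0) ⟨hs.1.le, self_mem_Ici⟩)
      hs.1.le).differentiableWithinAt.hasDerivWithinAt

variable [CompleteSpace E]

theorem hasDerivWithinAt_integral_Ici {f : ℝ → E} (hf : ContinuousOn f (Ici 0)) :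
    HasDerivWithinAt (fun t => ∫ s in (0 : ℝ)..t, f s) (f 0) (Ici 0) 0 :=
  intervalIntegral.integral_hasDerivWithinAt_right (t := Ioi 0) (by simp)
    ((hf.mono Ioi_subset_Ici_self).stronglyMeasurableAtFilter_nhdsWithin measurableSet_Ioi 0)
    ((hf 0 self_mem_Ici).mono Ioi_subset_Ici_self)

theorem eventually_eq_zero_of_iteratedDeriv_eq_zero {f : ℝ → E} {x : ℝ} (hf : AnalyticAt ℝ f x)
    (h : ∀ n, iteratedDeriv n f x = 0) : ∀ᶠ y in 𝓝 x, f y = 0 := by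
  refine analyticOrderAt_eq_top.1 (ENat.eq_top_iff_forall_ge.2 fun n => ?_)
  exact (natCast_le_analyticOrderAt_iff_iteratedDeriv_eq_zero hf).2 fun i _ => h i

theorem eventually_eq_zero_of_iteratedDerivWithin_eq_zero {f : ℝ → E} {s : Set ℝ} {x : ℝ}
    (hf : AnalyticWithinAt ℝ f s x) (hs : UniqueDiffOn ℝ s) (hx : x ∈ s)
    (h : ∀ n, iteratedDerivWithin n f s x = 0) : ∀ᶠ t in 𝓝[s] x, f t = 0 := by
  obtain ⟨g, hfg, hg⟩ := analyticWithinAt_iff_exists_analyticAt.1 hf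
  rw [insert_eq_of_mem hx] at hfg
  have hg0 : ∀ᶠ t in 𝓝 x, g t = 0 := by
    refine eventually_eq_zero_of_iteratedDeriv_eq_zero hg fun n => ?_
    rw [← iteratedDerivWithin_eq_iteratedDeriv hs hg.contDiffAt hx, ← h n, iteratedDerivWithin,
      iteratedDerivWithin, hfg.iteratedFDerivWithin_eq (hfg.self_of_nhdsWithin hx)]
  filter_upwards [hfg, nhdsWithin_le_nhds hg0] with t ht ht0
  rw [ht, ht0]

theorem eqOn_Ici_zero_of_iteratedDerivWithin_eq_zero {f : ℝ → E} {a : ℝ}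
    (hf : AnalyticOn ℝ f (Ici a)) (h : ∀ n, iteratedDerivWithin n f (Ici a) a = 0) :
    EqOn f 0 (Ici a) := by
  have hev := eventually_eq_zero_of_iteratedDerivWithin_eq_zero (hf a self_mem_Ici)
    (uniqueDiffOn_Ici a) self_mem_Ici h
  obtain ⟨b, hab, hsub⟩ := mem_nhdsGE_iff_exists_Ico_subset.1 hev
  obtain ⟨c, hac, hcb⟩ := exists_between (show a < b from hab)
  have hIoi : EqOn f 0 (Ioi a) := by
    refine AnalyticOnNhd.eqOn_zero_of_preconnected_of_eventuallyEq_zero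
      (isOpen_Ioi.analyticOn_iff_analyticOnNhd.1 (hf.mono Ioi_subset_Ici_self))
      isPreconnected_Ioi (z₀ := c) hac ?_
    filter_upwards [Ioo_mem_nhds hac hcb] with t ht using hsub ⟨ht.1.le, ht.2⟩
  rw [← Ioi_insert, EqOn, forall_mem_insert]
  exact ⟨hev.self_of_nhdsWithin self_mem_Ici, hIoi⟩

theorem eqOn_Ici_of_iteratedDerivWithin_eq {f g : ℝ → E} {a : ℝ} (hf : AnalyticOn ℝ f (Ici a))
    (hg : AnalyticOn ℝ g (Ici a))
    (h : ∀ n, iteratedDerivWithin n f (Ici a) a = iteratedDerivWithin n g (Ici a) a) :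
    EqOn f g (Ici a) := fun t ht => by
  refine sub_eq_zero.1 (eqOn_Ici_zero_of_iteratedDerivWithin_eq_zero (hf.sub hg) (fun n => ?_) ht)
  rw [iteratedDerivWithin_sub self_mem_Ici (uniqueDiffOn_Ici a)
    (hf.contDiffOn (uniqueDiffOn_Ici a) a self_mem_Ici)
    (hg.contDiffOn (uniqueDiffOn_Ici a) a self_mem_Ici), h n, sub_self]

end Calculus

/-! ### Functions that are analytic in the dwell times -/

section AnalyticInTimes

variable {Q X E : Type*} [NormedAddCommGroup E] [NormedSpace ℝ E]

/-- A switching sequence regarded as one whose times are constant functions on `X`. -/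
def constTimes (X : Type*) (l : List (Q × ℝ≥0)) : List (Q × (X → ℝ)) :=
  l.map fun c => (c.1, fun _ => (c.2 : ℝ))

@[simp]
theorem map_constTimes (l : List (Q × ℝ≥0)) (x : X) :
    ((constTimes X l).map fun c => (c.1, (c.2 x).toNNReal)) = l := by
  simp [constTimes, Function.comp_def]

variable [NormedAddCommGroup X] [NormedSpace ℝ X] {s : Set X}

theorem analyticOn_mapsTo_of_mem_constTimes {l : List (Q × ℝ≥0)} :
    ∀ c ∈ constTimes X l, AnalyticOn ℝ c.2 s ∧ MapsTo c.2 s (Ici 0) := by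
  simp only [constTimes, List.forall_mem_map]
  exact fun c _ => ⟨analyticOn_const, fun _ _ => c.2.2⟩

theorem analyticOn_mapsTo_eval {k : ℕ} (q : Fin k → Q) :
    ∀ c ∈ List.ofFn fun i => (q i, fun t : Fin k → ℝ => t i),
      AnalyticOn ℝ c.2 {t | ∀ i, 0 ≤ t i} ∧ MapsTo c.2 {t | ∀ i, 0 ≤ t i} (Ici 0) := by
  rw [List.forall_mem_ofFn_iff]
  exact fun i => ⟨(ContinuousLinearMap.proj (R := ℝ) (φ := fun _ : Fin k => ℝ) i).analyticOn _,
    fun t ht => ht i⟩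

theorem uniqueDiffOn_orthant (k : ℕ) : UniqueDiffOn ℝ {t : Fin k → ℝ | ∀ i, 0 ≤ t i} := by
  have h : {t : Fin k → ℝ | ∀ i, 0 ≤ t i} = univ.pi fun _ => Ici (0 : ℝ) := by
    ext; simp [Pi.le_def]
  exact h ▸ UniqueDiffOn.univ_pi fun _ => uniqueDiffOn_Ici 0

namespace AnalyticInTimes

variable {F : List (Q × ℝ≥0) → E} (hF : AnalyticInTimes F)
include hF

theorem comp_map (l : List (Q × (X → ℝ)))
    (hl : ∀ c ∈ l, AnalyticOn ℝ c.2 s ∧ MapsTo c.2 s (Ici 0)) :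
    AnalyticOn ℝ (fun x => F (l.map fun c => (c.1, (c.2 x).toNNReal))) s := by
  refine ((hF l.length fun i => l[i].1).comp (g := fun x i => l[i].2 x)
    (AnalyticOn.pi fun i => (hl _ (l.get_mem i)).1)
    fun x hx i => (hl _ (l.get_mem i)).2 hx).congr fun x _ => ?_
  simp only [Function.comp_apply]
  congr 1
  exact (List.ofFn_getElem_eq_map l _).symm

theorem append (l₁ l₂ : List (Q × ℝ≥0)) : AnalyticInTimes fun l => F (l₁ ++ l ++ l₂) := by
  intro k q
  have h := hF.comp_map
    (constTimes _ l₁ ++ (List.ofFn fun i => (q i, fun t : Fin k → ℝ => t i)) ++ constTimes _ l₂)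
    (List.forall_mem_append.2 ⟨List.forall_mem_append.2
      ⟨analyticOn_mapsTo_of_mem_constTimes, analyticOn_mapsTo_eval q⟩,
      analyticOn_mapsTo_of_mem_constTimes⟩)
  simpa [List.map_ofFn, Function.comp_def] using h

theorem cons (c : Q × ℝ≥0) : AnalyticInTimes fun l => F (c :: l) := by
  simpa using hF.append [c] []

theorem concat (c : Q × ℝ≥0) : AnalyticInTimes fun l => F (l ++ [c]) := by
  simpa using hF.append [] [c]

theorem analyticOn_single (l₁ l₂ : List (Q × ℝ≥0)) (q : Q) :
    AnalyticOn ℝ (fun t : ℝ => F (l₁ ++ (q, t.toNNReal) :: l₂)) (Ici 0) := by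
  have h := hF.comp_map (constTimes _ l₁ ++ (q, id) :: constTimes _ l₂)
    (List.forall_mem_append.2 ⟨analyticOn_mapsTo_of_mem_constTimes, List.forall_mem_cons.2
      ⟨⟨analyticOn_id, mapsTo_id (Ici 0)⟩, analyticOn_mapsTo_of_mem_constTimes⟩⟩)
  simpa using h

theorem analyticOn_first_last (l : List (Q × ℝ≥0)) (q q' : Q) :
    AnalyticOn ℝ (fun z : ℝ × ℝ => F ((q, z.1.toNNReal) :: (l ++ [(q', z.2.toNNReal)])))
      (Ici 0 ×ˢ Ici 0) := by
  have h := hF.comp_map ((q, Prod.fst) :: (constTimes _ l ++ [(q', Prod.snd)]))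
    (List.forall_mem_cons.2 ⟨⟨analyticOn_fst, mapsTo_fst_prod⟩, List.forall_mem_append.2
      ⟨analyticOn_mapsTo_of_mem_constTimes, List.forall_mem_singleton.2
        ⟨analyticOn_snd, mapsTo_snd_prod (s := Ici 0) (t := Ici 0)⟩⟩⟩)
  simpa using h

theorem add_const (c : E) : AnalyticInTimes fun l => F l + c :=
  fun k q => (hF k q).add analyticOn_const

end AnalyticInTimes

/-- The derivative of `F` at `0` with respect to an additional last time, spent in the mode `q`. -/
def lastDeriv (F : List (Q × ℝ≥0) → E) (q : Q) (l : List (Q × ℝ≥0)) : E :=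
  derivWithin (fun t : ℝ => F (l ++ [(q, t.toNNReal)])) (Ici 0) 0

theorem lastDeriv_append_left (F : List (Q × ℝ≥0) → E) (q : Q) (l : List (Q × ℝ≥0)) :
    lastDeriv (fun l' => F (l ++ l')) q = fun l' => lastDeriv F q (l ++ l') := by
  unfold lastDeriv
  simp only [List.append_assoc]

theorem AnalyticInTimes.lastDeriv {F : List (Q × ℝ≥0) → E} (hF : AnalyticInTimes F) (q : Q) :
    AnalyticInTimes (lastDeriv F q) := by
  intro k q'
  have hfst : ∀ c ∈ List.ofFn fun i => (q' i, fun z : (Fin k → ℝ) × ℝ => z.1 i),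
      AnalyticOn ℝ c.2 ({t | ∀ i, 0 ≤ t i} ×ˢ Ici 0) ∧
        MapsTo c.2 ({t | ∀ i, 0 ≤ t i} ×ˢ Ici 0) (Ici 0) :=
    List.forall_mem_ofFn_iff.2 fun i =>
      ⟨(((ContinuousLinearMap.proj (R := ℝ) (φ := fun _ : Fin k => ℝ) i).comp
        (ContinuousLinearMap.fst ℝ _ ℝ))).analyticOn _, fun z hz => hz.1 i⟩
  have h := hF.comp_map
    ((List.ofFn fun i => (q' i, fun z : (Fin k → ℝ) × ℝ => z.1 i)) ++ [(q, Prod.snd)])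
    (List.forall_mem_append.2 ⟨hfst, List.forall_mem_singleton.2
      ⟨analyticOn_snd, mapsTo_snd_prod (t := Ici 0)⟩⟩)
  simpa [SwitchedSystem.lastDeriv, List.map_ofFn, Function.comp_def] using
    analyticOn_derivWithin_partial_snd h (uniqueDiffOn_orthant k) (uniqueDiffOn_Ici 0) self_mem_Ici

theorem AnalyticInTimes.hasDerivWithinAt_lastDeriv {F : List (Q × ℝ≥0) → E}
    (hF : AnalyticInTimes F) (q : Q) (l : List (Q × ℝ≥0)) :
    HasDerivWithinAt (fun t : ℝ => F (l ++ [(q, t.toNNReal)])) (SwitchedSystem.lastDeriv F q l)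
      (Ici 0) 0 :=
  ((hF.analyticOn_single l [] q).differentiableOn 0 self_mem_Ici).hasDerivWithinAt

/-- The response to a constant input, `G` being the kernel multiplied by the value of the input:
the sum of the integrals of `G` over the first time of the suffixes of the switching sequence. -/
def constInput (G : List (Q × ℝ≥0) → E) : List (Q × ℝ≥0) → E
  | [] => 0
  | (q, t) :: l => (∫ s in (0 : ℝ)..t, G ((q, s.toNNReal) :: l)) + constInput G l

theorem hasDerivWithinAt_constInput [CompleteSpace E] {G : List (Q × ℝ≥0) → E}
    (hG : AnalyticInTimes G) (q : Q) (l : List (Q × ℝ≥0)) :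
    HasDerivWithinAt (fun t : ℝ => constInput G (l ++ [(q, t.toNNReal)]))
      (constInput (lastDeriv G q) l + G [(q, 0)]) (Ici 0) 0 := by
  induction l with
  | nil =>
    have h := hasDerivWithinAt_integral_Ici (hG.analyticOn_single [] [] q).continuousOn
    simp only [List.nil_append, Real.toNNReal_zero] at h
    simp only [constInput, List.nil_append, add_zero, zero_add]
    exact h.congr (fun t ht => by rw [Real.coe_toNNReal t ht]) (by simp)
  | cons c l ih =>
    have h := hasDerivWithinAt_integral_of_analyticOn (hG.analyticOn_first_last l c.1 q) c.2.2
    simp only [constInput, List.cons_append, add_assoc]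
    exact h.add ih

theorem lastDeriv_add_constInput [CompleteSpace E] {K G : List (Q × ℝ≥0) → E}
    (hK : AnalyticInTimes K) (hG : AnalyticInTimes G) (q : Q) :
    lastDeriv (fun l => K l + constInput G l) q =
      fun l => lastDeriv K q l + G [(q, 0)] + constInput (lastDeriv G q) l := by
  funext l
  rw [add_assoc, add_comm (G _)]
  exact ((hK.hasDerivWithinAt_lastDeriv q l).add (hasDerivWithinAt_constInput hG q l)).derivWithin
    (uniqueDiffOn_Ici 0 0 self_mem_Ici)

end AnalyticInTimes

/-! ### Mixed derivatives -/

section MixedDeriv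

variable {Q : Type*} {p : ℕ} {F K G : List (Q × ℝ≥0) → Fin p → ℝ}

theorem mixedDeriv_concat (F : List (Q × ℝ≥0) → Fin p → ℝ) (w : List Q) (q : Q) :
    mixedDeriv F (w ++ [q]) = mixedDeriv (lastDeriv F q) w := by
  induction w generalizing F with
  | nil => rfl
  | cons a w ih =>
    simp only [List.cons_append, mixedDeriv, ih]
    rfl

theorem mixedDeriv_zero (w : List Q) :
    mixedDeriv (fun _ => 0 : List (Q × ℝ≥0) → Fin p → ℝ) w = 0 := by
  induction w with
  | nil => rfl
  | cons a w ih => simp [mixedDeriv, ih]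

theorem mixedDeriv_add_const (F : List (Q × ℝ≥0) → Fin p → ℝ) (c : Fin p → ℝ) {w : List Q}
    (hw : w ≠ []) : mixedDeriv (fun l => F l + c) w = mixedDeriv F w := by
  rw [← List.dropLast_append_getLast hw, mixedDeriv_concat, mixedDeriv_concat]
  congr 1
  funext l
  exact derivWithin_add_const c

/-- Only the last integral survives the first differentiation with respect to a last time, and it
is evaluated by the fundamental theorem of calculus; the others keep their shape. -/
theorem mixedDeriv_add_constInput (hK : AnalyticInTimes K) (hG : AnalyticInTimes G) (q₀ : Q)
    (w : List Q) :
    mixedDeriv (fun l => K l + constInput G l) (q₀ :: w) =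
      mixedDeriv K (q₀ :: w) + mixedDeriv (fun l => G ((q₀, 0) :: l)) w := by
  induction w using List.reverseRecOn generalizing K G with
  | nil =>
    rw [← List.nil_append [q₀], mixedDeriv_concat, mixedDeriv_concat,
      lastDeriv_add_constInput hK hG]
    simp only [mixedDeriv, constInput, add_zero]
  | append_singleton w q ih =>
    rw [← List.cons_append, mixedDeriv_concat, mixedDeriv_concat, mixedDeriv_concat,
      lastDeriv_add_constInput hK hG, ih ((hK.lastDeriv q).add_const _) (hG.lastDeriv q),
      mixedDeriv_add_const _ _ (List.cons_ne_nil _ _)]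
    rfl

theorem AnalyticInTimes.mixedDeriv (hF : AnalyticInTimes F) (w : List Q) :
    AnalyticInTimes fun l => mixedDeriv (fun l' => F (l ++ l')) w := by
  induction w using List.reverseRecOn generalizing F with
  | nil => simpa only [SwitchedSystem.mixedDeriv, List.append_nil] using hF
  | append_singleton w q ih =>
    simpa only [mixedDeriv_concat, lastDeriv_append_left] using ih (hF.lastDeriv q)

end MixedDeriv

/-! ### The identity theorem for kernels -/

section IsKernel

variable {Q : Type*} {p : ℕ}

/-- The conditions imposed on the family of kernels `K_w`, `w` a non-empty word, of a generalized
kernel representation. As in `HasGeneralizedKernelRepresentation`, `K_{q₁⋯q_k}(t₁,…,t_k)` is written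
`K [(q₁,t₁),…,(q_k,t_k)]`. -/
structure IsKernel (K : List (Q × ℝ≥0) → Fin p → ℝ) : Prop where
  analytic : AnalyticInTimes K
  merge : ∀ (w v : List (Q × ℝ≥0)) (q : Q) (t t' : ℝ≥0),
    K (w ++ (q, t) :: (q, t') :: v) = K (w ++ (q, t + t') :: v)
  drop_zero : ∀ (v w : List (Q × ℝ≥0)) (q : Q), w ≠ [] → K (v ++ (q, 0) :: w) = K (v ++ w)

/-- The derivative of `K` at zero dwell times along `w`, after the switching sequence `l` and before
a final zero time in the mode `q`. -/
def jet (K : List (Q × ℝ≥0) → Fin p → ℝ) (q : Q) (w : List Q) (l : List (Q × ℝ≥0)) : Fin p → ℝ :=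
  mixedDeriv (fun l' => K (l ++ (l' ++ [(q, 0)]))) w

variable {K K' : List (Q × ℝ≥0) → Fin p → ℝ}

namespace IsKernel

theorem analyticInTimes_jet (hK : IsKernel K) (q : Q) (w : List Q) :
    AnalyticInTimes (jet K q w) := by
  unfold jet
  simpa only [List.append_assoc] using (hK.analytic.concat (q, 0)).mixedDeriv w

theorem jet_concat_zero (hK : IsKernel K) (q q₁ : Q) (w : List Q) (l : List (Q × ℝ≥0)) :
    jet K q w (l ++ [(q₁, 0)]) = jet K q w l := by
  simp [jet, hK.drop_zero]

theorem jet_nil_concat (hK : IsKernel K) (q : Q) (t : ℝ≥0) (l : List (Q × ℝ≥0)) :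
    jet K q [] (l ++ [(q, t)]) = K (l ++ [(q, t)]) := by
  simp [jet, mixedDeriv, hK.merge]

theorem derivWithin_jet (hK : IsKernel K) (q q₁ : Q) (w : List Q) (l : List (Q × ℝ≥0)) {t : ℝ}
    (ht : 0 ≤ t) :
    derivWithin (fun t : ℝ => jet K q w (l ++ [(q₁, t.toNNReal)])) (Ici 0) t =
      jet K q (q₁ :: w) (l ++ [(q₁, t.toNNReal)]) := by
  set D : ℝ → Fin p → ℝ := fun t => jet K q w (l ++ [(q₁, t.toNNReal)])
  have hD : HasDerivWithinAt D (derivWithin D (Ici 0) t) (Ici 0) (t + 0) := by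
    rw [add_zero]
    exact (((hK.analyticInTimes_jet q w).analyticOn_single l [] q₁).differentiableOn t
      ht).hasDerivWithinAt
  have hshift : HasDerivWithinAt (fun s => D (t + s)) (derivWithin D (Ici 0) t) (Ici 0) 0 := by
    have h := hD.scomp 0 (h := (t + ·)) (s := Ici 0) ((hasDerivWithinAt_id 0 _).const_add t)
      fun s hs => add_nonneg ht hs
    rwa [one_smul] at h
  have hmerge : ∀ s ∈ Ici (0 : ℝ), mixedDeriv (fun l' =>
      K (l ++ [(q₁, t.toNNReal)] ++ ((q₁, s.toNNReal) :: l' ++ [(q, 0)]))) w = D (t + s) := by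
    intro s hs
    simp [D, jet, hK.merge, Real.toNNReal_add ht hs]
  exact (hshift.congr hmerge (hmerge 0 self_mem_Ici)).derivWithin
    (uniqueDiffOn_Ici 0 0 self_mem_Ici) |>.symm

theorem iteratedDerivWithin_jet (hK : IsKernel K) (q q₁ : Q) (w : List Q) (l : List (Q × ℝ≥0))
    (n : ℕ) {t : ℝ} (ht : 0 ≤ t) :
    iteratedDerivWithin n (fun t : ℝ => jet K q w (l ++ [(q₁, t.toNNReal)])) (Ici 0) t =
      jet K q (List.replicate n q₁ ++ w) (l ++ [(q₁, t.toNNReal)]) := by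
  induction n generalizing t with
  | zero => simp
  | succ n ih =>
    rw [iteratedDerivWithin_succ,
      derivWithin_congr (s := Ici 0) (fun s hs => ih (t := s) hs) (ih ht),
      hK.derivWithin_jet q q₁ _ l ht, List.replicate_succ, List.cons_append]

theorem jet_eq_jet (hK : IsKernel K) (hK' : IsKernel K')
    (h : ∀ q w, jet K q w [] = jet K' q w []) (q : Q) (w : List Q) (l : List (Q × ℝ≥0)) :
    jet K q w l = jet K' q w l := by
  induction l using List.reverseRecOn generalizing w with
  | nil => exact h q w
  | append_singleton l c ih =>
    obtain ⟨q₁, t⟩ := c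
    have heq := eqOn_Ici_of_iteratedDerivWithin_eq
      ((hK.analyticInTimes_jet q w).analyticOn_single l [] q₁)
      ((hK'.analyticInTimes_jet q w).analyticOn_single l [] q₁) fun n => by
        rw [hK.iteratedDerivWithin_jet q q₁ w l n le_rfl,
          hK'.iteratedDerivWithin_jet q q₁ w l n le_rfl, Real.toNNReal_zero,
          hK.jet_concat_zero, hK'.jet_concat_zero, ih]
    simpa only [Real.toNNReal_coe] using heq (show (t : ℝ) ∈ Ici 0 from t.2)

theorem eq_of_mixedDeriv_eq (hK : IsKernel K) (hK' : IsKernel K')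
    (h : ∀ (q : Q) (w : List Q), mixedDeriv (fun l => K (l ++ [(q, 0)])) w =
      mixedDeriv (fun l => K' (l ++ [(q, 0)])) w)
    {l : List (Q × ℝ≥0)} (hl : l ≠ []) : K l = K' l := by
  rw [← List.dropLast_append_getLast hl]
  generalize l.dropLast = l, l.getLast hl = c
  rw [← hK.jet_nil_concat, ← hK'.jet_nil_concat]
  exact hK.jet_eq_jet hK' h _ _ _

end IsKernel

end IsKernel

/-! ### Piecewise-continuous inputs -/

section Inputs

variable {m : ℕ}

/-- The input `u`, started at time `τ`, as a function on the real line. -/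
def PC.shift (u : PC m) (τ : ℝ≥0) (s : ℝ) : Fin m → ℝ := u.1 (s.toNNReal + τ)

theorem PC.countable_not_continuousAt (u : PC m) : {s | ¬ ContinuousAt u.1 s}.Countable := by
  refine (countable_iUnion fun k : ℕ => (u.2.1 k).countable).mono fun s hs => ?_
  obtain ⟨k, hk⟩ := exists_nat_ge s
  exact mem_iUnion.2 ⟨k, hk, hs⟩

theorem PC.countable_not_continuousAt_shift (u : PC m) (τ : ℝ≥0) :
    {s : ℝ | 0 < s ∧ ¬ ContinuousAt (u.shift τ) s}.Countable := by
  refine MapsTo.countable_of_injOn (f := fun s : ℝ => s.toNNReal + τ)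
    (t := {s | ¬ ContinuousAt u.1 s}) ?_ ?_ u.countable_not_continuousAt
  · rintro s ⟨-, hs⟩ hc
    exact hs (ContinuousAt.comp (f := fun s : ℝ => s.toNNReal + τ) hc (by fun_prop))
  · rintro s ⟨hs, -⟩ s' ⟨hs', -⟩ h
    exact (Real.toNNReal_eq_toNNReal_iff hs.le hs'.le).1 (add_right_cancel h)

theorem PC.exists_isBounded_image (u : PC m) (s : ℝ≥0) :
    ∃ A ∈ 𝓝 s, Bornology.IsBounded (u.1 '' A) := by
  by_cases hs : ContinuousAt u.1 s
  · exact Metric.exists_isBounded_image_of_tendsto hs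
  · obtain ⟨⟨a, ha⟩, ⟨b, hb⟩⟩ := u.2.2 s hs
    obtain ⟨A, hA, hAb⟩ := Metric.exists_isBounded_image_of_tendsto ha
    obtain ⟨B, hB, hBb⟩ := Metric.exists_isBounded_image_of_tendsto hb
    refine ⟨B ∪ A ∪ {s}, ?_, ?_⟩
    · rw [← nhdsNE_sup_pure, ← nhdsLT_sup_nhdsGT]
      exact union_mem_sup (union_mem_sup hB hA) (mem_pure.2 rfl)
    · rw [image_union, image_union, image_singleton]
      exact (hBb.union hAb).union Bornology.isBounded_singleton

theorem PC.isBounded_image_of_isCompact (u : PC m) {A : Set ℝ≥0} (hA : IsCompact A) :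
    Bornology.IsBounded (u.1 '' A) := by
  refine hA.induction_on (p := fun A => Bornology.IsBounded (u.1 '' A)) (by simp)
    (fun A B hAB hB => hB.subset (image_mono hAB))
    (fun A B hA hB => by rw [image_union]; exact hA.union hB) fun s _ => ?_
  obtain ⟨B, hB, h⟩ := u.exists_isBounded_image s
  exact ⟨B, mem_nhdsWithin_of_mem_nhds hB, h⟩

theorem PC.aestronglyMeasurable_shift (u : PC m) (τ : ℝ≥0) (t : ℝ) :
    AEStronglyMeasurable (u.shift τ) (volume.restrict (Ioc 0 t)) := by
  set D := {s : ℝ | 0 < s ∧ ¬ ContinuousAt (u.shift τ) s}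
  have hD : D.Countable := u.countable_not_continuousAt_shift τ
  have hcont : ContinuousOn (u.shift τ) (Ioc 0 t \ D) := fun s hs =>
    (not_not.1 fun h => hs.2 ⟨hs.1.1, h⟩ : ContinuousAt (u.shift τ) s).continuousWithinAt
  have h := hcont.aestronglyMeasurable (μ := volume) (measurableSet_Ioc.diff hD.measurableSet)
  rwa [Measure.restrict_congr_set (sdiff_null_ae_eq_self (hD.measure_zero _))] at h

theorem PC.intervalIntegrable_shift (u : PC m) (τ : ℝ≥0) {t : ℝ} (ht : 0 ≤ t) :
    IntervalIntegrable (u.shift τ) volume 0 t := by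
  obtain ⟨C, hC⟩ := (u.isBounded_image_of_isCompact
    (isCompact_Icc (a := 0) (b := t.toNNReal + τ))).exists_norm_le
  rw [intervalIntegrable_iff_integrableOn_Ioc_of_le ht]
  refine Integrable.of_bound (u.aestronglyMeasurable_shift τ t) C ?_
  rw [ae_restrict_iff' measurableSet_Ioc]
  refine Eventually.of_forall fun s hs => hC _ (mem_image_of_mem _ ⟨zero_le, ?_⟩)
  gcongr
  exact hs.2

end Inputs

/-! ### Variation of constants -/

section Duhamel

variable {E F : Type*} [NormedAddCommGroup E] [NormedSpace ℝ E] [NormedAddCommGroup F]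
  [NormedSpace ℝ F]

theorem intervalIntegrable_clm_apply {T : ℝ → E →L[ℝ] F} {f : ℝ → E} {a b : ℝ}
    (hT : Continuous T) (hf : IntervalIntegrable f volume a b) :
    IntervalIntegrable (fun s => T s (f s)) volume a b := by
  obtain ⟨C, hC⟩ := (isCompact_uIcc (a := a) (b := b)).exists_bound_of_continuousOn hT.continuousOn
  rw [intervalIntegrable_iff] at hf ⊢
  refine (ContinuousLinearMap.id ℝ (E →L[ℝ] F)).integrable_of_bilin_of_bdd_left C
    hT.aestronglyMeasurable.restrict ?_ hf
  rw [ae_restrict_iff' measurableSet_uIoc]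
  exact Eventually.of_forall fun s hs => hC s (uIoc_subset_uIcc hs)

variable (L : E →L[ℝ] E) {f x : ℝ → E}

/-- The flow `e^{tL}` of the linear differential equation `ẋ = L x`. -/
def expFlow (t : ℝ) : E →L[ℝ] E := NormedSpace.exp (t • L)

@[simp]
theorem expFlow_zero : expFlow L 0 = 1 := by
  simp [expFlow]

variable [CompleteSpace E]

theorem analyticAt_expFlow (t : ℝ) : AnalyticAt ℝ (expFlow L) t :=
  (NormedSpace.exp_analytic (𝕂 := ℝ) (t • L)).comp (f := fun t : ℝ => t • L)
    (analyticAt_id.smul analyticAt_const)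

theorem hasDerivAt_expFlow (t : ℝ) : HasDerivAt (expFlow L) (L * expFlow L t) t :=
  hasDerivAt_exp_smul_const' (𝕂 := ℝ) L t

theorem continuous_expFlow : Continuous (expFlow L) :=
  continuous_iff_continuousAt.2 fun t => (hasDerivAt_expFlow L t).continuousAt

theorem expFlow_add (s t : ℝ) : expFlow L (s + t) = expFlow L s * expFlow L t := by
  let _ : NormedAlgebra ℚ (E →L[ℝ] E) := NormedAlgebra.restrictScalars ℚ ℝ _
  rw [expFlow, add_smul, NormedSpace.exp_add_of_commute]
  · rfl
  · exact ((Commute.refl _).smul_left _).smul_right _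

theorem expFlow_apply_expFlow (s t : ℝ) (x : E) :
    expFlow L s (expFlow L t x) = expFlow L (s + t) x := by
  rw [expFlow_add]
  rfl

theorem hasDerivAt_expFlow_neg_apply {y : E} {s : ℝ} (hx : HasDerivAt x (L (x s) + y) s) :
    HasDerivAt (fun s => expFlow L (-s) (x s)) (expFlow L (-s) y) s := by
  have hneg : HasDerivAt (fun s => expFlow L (-s)) (-(expFlow L (-s) * L)) s := by
    simpa [expFlow, Function.comp_def] using
      (hasDerivAt_exp_smul_const (𝕂 := ℝ) L (-s)).scomp s (hasDerivAt_neg s)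
  refine (hneg.clm_apply hx).congr_deriv ?_
  simp

/-- The solution at time `t` of `ẋ = L x + f` with `x(0) = x₀`, given by the variation-of-constants
formula. -/
def duhamel (f : ℝ → E) (x₀ : E) (t : ℝ) : E :=
  expFlow L t x₀ + ∫ s in (0 : ℝ)..t, expFlow L (t - s) (f s)

theorem intervalIntegrable_expFlow_sub_apply {a b : ℝ} (hf : IntervalIntegrable f volume a b)
    (r : ℝ) : IntervalIntegrable (fun s => expFlow L (r - s) (f s)) volume a b :=
  intervalIntegrable_clm_apply ((continuous_expFlow L).comp (continuous_const.sub continuous_id)) hf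

theorem intervalIntegrable_expFlow_neg_apply {a b : ℝ} (hf : IntervalIntegrable f volume a b) :
    IntervalIntegrable (fun s => expFlow L (-s) (f s)) volume a b :=
  intervalIntegrable_clm_apply ((continuous_expFlow L).comp continuous_neg) hf

theorem duhamel_eq {t : ℝ} (hf : IntervalIntegrable f volume 0 t) (x₀ : E) :
    duhamel L f x₀ t = expFlow L t (x₀ + ∫ s in (0 : ℝ)..t, expFlow L (-s) (f s)) := by
  rw [duhamel, map_add, ← ContinuousLinearMap.intervalIntegral_comp_comm _
    (intervalIntegrable_expFlow_neg_apply L hf)]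
  simp only [expFlow_apply_expFlow, sub_eq_add_neg]

theorem eq_duhamel {D : Set ℝ} (hD : D.Countable) {t : ℝ} (ht : 0 ≤ t)
    (hf : IntervalIntegrable f volume 0 t) (hc : ContinuousOn x (Icc 0 t))
    (hx : ∀ s ∈ Ioo 0 t \ D, HasDerivAt x (L (x s) + f s) s) :
    x t = duhamel L f (x 0) t := by
  have h := integral_eq_of_hasDerivAt_off_countable (fun s => expFlow L (-s) (x s))
    (fun s => expFlow L (-s) (f s)) (a := 0) (b := t) hD ?_ ?_
    (intervalIntegrable_expFlow_neg_apply L hf)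
  · rw [duhamel_eq L hf, h]
    simp [expFlow_apply_expFlow]
  · rw [uIcc_of_le ht]
    exact ((continuous_expFlow L).comp continuous_neg).continuousOn.clm_apply hc
  · rw [min_eq_left ht, max_eq_right ht]
    exact fun s hs => hasDerivAt_expFlow_neg_apply L (hx s hs)

theorem continuousOn_duhamel (hf : ∀ t, 0 ≤ t → IntervalIntegrable f volume 0 t) (x₀ : E) :
    ContinuousOn (duhamel L f x₀) (Ici 0) := by
  refine ContinuousOn.congr ((continuous_expFlow L).continuousOn.clm_apply
    (continuousOn_const.add fun t ht => ?_)) fun t ht => duhamel_eq L (hf t ht) x₀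
  have ht₁ : 0 ≤ t + 1 := add_nonneg ht zero_le_one
  have h := intervalIntegral.continuousOn_primitive_interval'
    (intervalIntegrable_expFlow_neg_apply L (hf (t + 1) ht₁)) left_mem_uIcc
  rw [uIcc_of_le ht₁, ← Ici_inter_Iic] at h
  exact (h t ⟨ht, (lt_add_one t).le⟩).mono_of_mem_nhdsWithin
    (inter_mem_nhdsWithin _ (Iic_mem_nhds (lt_add_one t)))

theorem hasDerivAt_duhamel (hf : ∀ t, 0 ≤ t → IntervalIntegrable f volume 0 t) (x₀ : E) {t : ℝ}
    (ht : 0 < t) (hft : ContinuousAt f t) :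
    HasDerivAt (duhamel L f x₀) (L (duhamel L f x₀ t) + f t) t := by
  have hint : ∀ {b}, 0 ≤ b → IntervalIntegrable (fun s => expFlow L (-s) (f s)) volume 0 b :=
    fun hb => intervalIntegrable_expFlow_neg_apply L (hf _ hb)
  have hmeas : StronglyMeasurableAtFilter (fun s => expFlow L (-s) (f s)) (𝓝 t) volume := by
    have ht₁ : 0 ≤ t + 1 := by positivity
    exact ⟨Ioc 0 (t + 1), Ioc_mem_nhds ht (lt_add_one t),
      ((intervalIntegrable_iff_integrableOn_Ioc_of_le ht₁).1 (hint ht₁)).aestronglyMeasurable⟩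
  have hcont : ContinuousAt (fun s => expFlow L (-s) (f s)) t :=
    ((continuous_expFlow L).comp continuous_neg).continuousAt.clm_apply hft
  have h := (hasDerivAt_expFlow L t).clm_apply
    ((intervalIntegral.integral_hasDerivAt_right (hint ht.le) hmeas hcont).const_add x₀)
  refine (h.congr_deriv ?_).congr_of_eventuallyEq ?_
  · rw [duhamel_eq L (hf t ht.le)]
    simp [expFlow_apply_expFlow]
  · filter_upwards [Ioi_mem_nhds ht] with s hs using duhamel_eq L (hf s (le_of_lt hs)) x₀

end Duhamel

section Solution

variable {n m : ℕ}

/-- A matrix as a continuous linear map. -/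
def mulVecCLM (A : Matrix (Fin n) (Fin m) ℝ) : (Fin m → ℝ) →L[ℝ] (Fin n → ℝ) :=
  LinearMap.toContinuousLinearMap A.mulVecLin

@[simp]
theorem mulVecCLM_apply (A : Matrix (Fin n) (Fin m) ℝ) (x : Fin m → ℝ) :
    mulVecCLM A x = A *ᵥ x := rfl

variable (A : Matrix (Fin n) (Fin n) ℝ) (B : Matrix (Fin n) (Fin m) ℝ) (u : PC m) (τ : ℝ≥0)
  (x₀ : Fin n → ℝ)

theorem intervalIntegrable_mulVec_shift {t : ℝ} (ht : 0 ≤ t) :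
    IntervalIntegrable (fun s => B *ᵥ u.shift τ s) volume 0 t :=
  intervalIntegrable_clm_apply (T := fun _ => mulVecCLM B) continuous_const
    (u.intervalIntegrable_shift τ ht)

theorem isSolution_duhamel : IsSolution A B (u.shift τ) x₀
    (duhamel (mulVecCLM A) (fun s => B *ᵥ u.shift τ s) x₀) := by
  have hf := fun t (ht : 0 ≤ t) => intervalIntegrable_mulVec_shift B u τ ht
  exact ⟨continuousOn_duhamel _ hf x₀, by simp [duhamel], fun t ht hu =>
    hasDerivAt_duhamel _ hf x₀ ht ((mulVecCLM B).continuous.continuousAt.comp hu)⟩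

theorem solution_eq_duhamel {t : ℝ} (ht : 0 ≤ t) :
    solution A B (u.shift τ) x₀ t =
      duhamel (mulVecCLM A) (fun s => B *ᵥ u.shift τ s) x₀ t := by
  obtain ⟨hc, h0, hd⟩ : IsSolution A B (u.shift τ) x₀ (solution A B (u.shift τ) x₀) :=
    Classical.epsilon_spec ⟨_, isSolution_duhamel A B u τ x₀⟩
  have h := eq_duhamel (mulVecCLM A) (u.countable_not_continuousAt_shift τ) ht
    (intervalIntegrable_mulVec_shift B u τ ht) (hc.mono Icc_subset_Ici_self)
    fun s hs => hd s hs.1.1 (not_not.1 fun h => hs.2 ⟨hs.1.1, h⟩)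
  rwa [h0] at h

end Solution

/-! ### Kernel representations of input-output maps -/

section Representation

variable {Q : Type*} {m p : ℕ}

section InputTerm

variable (G : List (Q × ℝ≥0) → (Fin m → ℝ) →ₗ[ℝ] (Fin p → ℝ))

/-- The contribution of the input `u`, read from time `τ` on, to the output of an input-output map
whose input kernels are `G`. -/
def inputTerm (u : ℝ≥0 → Fin m → ℝ) : ℝ≥0 → List (Q × ℝ≥0) → Fin p → ℝ
  | _, [] => 0
  | τ, (q, t) :: l =>
      (∫ s in (0 : ℝ)..t, G ((q, ((t : ℝ) - s).toNNReal) :: l) (u (s.toNNReal + τ))) +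
        inputTerm u (τ + t) l

theorem inputTerm_eq_sum (u : ℝ≥0 → Fin m → ℝ) (τ : ℝ≥0) (l : List (Q × ℝ≥0)) :
    inputTerm G u τ l = ∑ i : Fin l.length,
      ∫ s in (0 : ℝ)..((l.get i).2 : ℝ),
        G (((l.get i).1, (((l.get i).2 : ℝ) - s).toNNReal) :: l.drop (i + 1))
          (u (s.toNNReal + (τ + ((l.take i).map Prod.snd).sum))) := by
  induction l generalizing τ with
  | nil => simp [inputTerm]
  | cons c l ih =>
    rw [inputTerm, ih]
    refine Eq.trans ?_ (Fin.sum_univ_succ (n := l.length) _).symm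
    simp [add_assoc]

theorem inputTerm_const (a : Fin m → ℝ) (τ : ℝ≥0) (l : List (Q × ℝ≥0)) :
    inputTerm G (fun _ => a) τ l = constInput (fun l => G l a) l := by
  induction l generalizing τ with
  | nil => rfl
  | cons c l ih =>
    rw [inputTerm, constInput, ih,
      intervalIntegral.integral_comp_sub_left (fun s => G ((c.1, s.toNNReal) :: l) a)]
    simp

variable {G}

theorem inputTerm_congr {G' : List (Q × ℝ≥0) → (Fin m → ℝ) →ₗ[ℝ] (Fin p → ℝ)}
    (h : ∀ l, l ≠ [] → G l = G' l) (u : ℝ≥0 → Fin m → ℝ) (τ : ℝ≥0) (l : List (Q × ℝ≥0)) :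
    inputTerm G u τ l = inputTerm G' u τ l := by
  induction l generalizing τ with
  | nil => rfl
  | cons c l ih => simp only [inputTerm, ih, h _ (List.cons_ne_nil _ _)]

end InputTerm

section ConstInput

variable {E : Type*} [NormedAddCommGroup E] [NormedSpace ℝ E]

theorem constInput_zero (l : List (Q × ℝ≥0)) : constInput (fun _ => (0 : E)) l = 0 := by
  induction l with
  | nil => rfl
  | cons c l ih => simp [constInput, ih]

theorem constInput_concat_zero (G : List (Q × ℝ≥0) → E) (q : Q) (l : List (Q × ℝ≥0)) :
    constInput G (l ++ [(q, 0)]) = constInput (fun l => G (l ++ [(q, 0)])) l := by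
  induction l with
  | nil => simp [constInput]
  | cons c l ih => simp [constInput, ih]

end ConstInput

/-- `f` is represented by the state kernels `K` and the input kernels `G`, the latter being regarded
as linear maps. This is the content of a generalized kernel representation for a single map `f`. -/
structure IsRepresentedBy (f : IOMap Q m p) (K : List (Q × ℝ≥0) → Fin p → ℝ)
    (G : List (Q × ℝ≥0) → (Fin m → ℝ) →ₗ[ℝ] (Fin p → ℝ)) : Prop where
  isKernel : IsKernel K
  analytic : ∀ a, AnalyticInTimes fun l => G l a
  merge : ∀ (w v : List (Q × ℝ≥0)) (q : Q) (t t' : ℝ≥0),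
    G (w ++ (q, t) :: (q, t') :: v) = G (w ++ (q, t + t') :: v)
  drop_zero : ∀ (v w : List (Q × ℝ≥0)) (q : Q), w ≠ [] → v ≠ [] →
    G (v ++ (q, 0) :: w) = G (v ++ w)
  eq : ∀ (u : PC m) (w : SwitchSeq Q), f u w = K w.1 + inputTerm G u.1 0 w.1

namespace IsRepresentedBy

variable {f f' : IOMap Q m p} {K K' : List (Q × ℝ≥0) → Fin p → ℝ}
  {G G' : List (Q × ℝ≥0) → (Fin m → ℝ) →ₗ[ℝ] (Fin p → ℝ)}

theorem apply_const (h : IsRepresentedBy f K G) (a : Fin m → ℝ) (q : Q) (l : List (Q × ℝ≥0)) :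
    f (PC.const a) ⟨l ++ [(q, 0)], by simp⟩ =
      K (l ++ [(q, 0)]) + constInput (fun l => G (l ++ [(q, 0)]) a) l := by
  rw [h.eq, PC.const, inputTerm_const, constInput_concat_zero]

theorem markovState_eq (h : IsRepresentedBy f K G) (q : Q) (w : List Q) :
    markovState f q w = mixedDeriv (fun l => K (l ++ [(q, 0)])) w := by
  simp only [markovState, ioDeriv, h.apply_const, map_zero, constInput_zero, add_zero]

theorem markovInput_eq (h : IsRepresentedBy f K G) (q q₀ : Q) (j : Fin m) (w : List Q) :
    markovInput f q q₀ j w =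
      mixedDeriv (fun l => G ((q₀, 0) :: (l ++ [(q, 0)])) (Pi.single j 1)) w := by
  have h0 := h.markovState_eq q (q₀ :: w)
  rw [markovState] at h0
  rw [markovInput, h0]
  simp only [ioDeriv, h.apply_const]
  rw [mixedDeriv_add_constInput (h.isKernel.analytic.concat _)
    ((h.analytic (Pi.single j 1)).concat _), add_sub_cancel_left]
  rfl

theorem isKernel_cons (h : IsRepresentedBy f K G) (q₀ : Q) (a : Fin m → ℝ) :
    IsKernel fun l => G ((q₀, 0) :: l) a where
  analytic := (h.analytic a).cons _
  merge w v q t t' := congr($(h.merge ((q₀, 0) :: w) v q t t') a)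
  drop_zero v w q hw := congr($(h.drop_zero ((q₀, 0) :: v) w q hw (List.cons_ne_nil _ _)) a)

theorem cons_zero_cons (h : IsRepresentedBy f K G) (q : Q) (t : ℝ≥0) (l : List (Q × ℝ≥0)) :
    G ((q, 0) :: (q, t) :: l) = G ((q, t) :: l) := by
  simpa using h.merge [] l q 0 t

theorem eq_of_markov_eq (h : IsRepresentedBy f K G) (h' : IsRepresentedBy f' K' G')
    (hs : ∀ q w, markovState f q w = markovState f' q w)
    (hi : ∀ q q₀ j w, markovInput f q q₀ j w = markovInput f' q q₀ j w) : f = f' := by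
  have hK : ∀ l, l ≠ [] → K l = K' l := fun l hl =>
    h.isKernel.eq_of_mixedDeriv_eq h'.isKernel
      (fun q w => by rw [← h.markovState_eq, ← h'.markovState_eq, hs]) hl
  have hG : ∀ l, l ≠ [] → G l = G' l := by
    intro l hl
    obtain ⟨⟨q₀, t⟩, l, rfl⟩ := List.exists_cons_of_ne_nil hl
    refine LinearMap.pi_ext' fun j => LinearMap.ext_ring ?_
    rw [← h.cons_zero_cons, ← h'.cons_zero_cons]
    exact (h.isKernel_cons q₀ (Pi.single j 1)).eq_of_mixedDeriv_eq
      (h'.isKernel_cons q₀ (Pi.single j 1))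
      (fun q w => by rw [← h.markovInput_eq, ← h'.markovInput_eq, hi]) hl
  funext u w
  rw [h.eq, h'.eq, hK _ w.2, inputTerm_congr hG]

end IsRepresentedBy

theorem AnalyticInTimes.mulVec {G : List (Q × ℝ≥0) → Matrix (Fin p) (Fin m) ℝ}
    (hG : ∀ i j, AnalyticInTimes fun l => G l i j) (a : Fin m → ℝ) :
    AnalyticInTimes fun l => G l *ᵥ a := by
  intro k q
  refine AnalyticOn.pi fun i => ?_
  simp only [Matrix.mulVec, dotProduct]
  exact Finset.analyticOn_fun_sum _ fun j _ => (hG i j k q).mul analyticOn_const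

namespace HasGeneralizedKernelRepresentation

variable {Φ : Set (IOMap Q m p)}

theorem exists_isRepresentedBy (h : HasGeneralizedKernelRepresentation Φ) :
    ∃ G, ∀ f : Φ, ∃ K, IsRepresentedBy f.1 K G := by
  obtain ⟨K, G, ⟨hK, hG⟩, hmerge, hzero, heq⟩ := h
  exact ⟨fun l => (G l).mulVecLin, fun f => ⟨K f, {
    isKernel := ⟨hK f, fun w v q t t' => (hmerge w v q t t').1 f,
      fun v w q hw => (hzero v w q hw).1 f⟩
    analytic := AnalyticInTimes.mulVec hG
    merge := fun w v q t t' => by rw [(hmerge w v q t t').2]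
    drop_zero := fun v w q hw hv => by rw [(hzero v w q hw).2 hv]
    eq := fun u w => by
      simp only [heq, inputTerm_eq_sum, zero_add, Matrix.mulVecLin_apply] }⟩⟩

theorem markovInput_eq (h : HasGeneralizedKernelRepresentation Φ) (f f' : Φ) (q q₀ : Q)
    (j : Fin m) (w : List Q) : markovInput f.1 q q₀ j w = markovInput f'.1 q q₀ j w := by
  obtain ⟨G, hG⟩ := h.exists_isRepresentedBy
  obtain ⟨K, hK⟩ := hG f
  obtain ⟨K', hK'⟩ := hG f'
  rw [hK.markovInput_eq, hK'.markovInput_eq]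

end HasGeneralizedKernelRepresentation

end Representation

/-! ### Kernels and Markov parameters of linear switched systems -/

namespace LSS

variable {Q : Type*} {m p n : ℕ} (S : LSS Q m p n)

/-- The flow of the autonomous switched system `ẋ = A_q x` along a switching sequence. -/
def flow : List (Q × ℝ≥0) → (Fin n → ℝ) →L[ℝ] (Fin n → ℝ)
  | [] => 1
  | (q, t) :: l => flow l * expFlow (mulVecCLM (S.A q)) t

/-- The output map `C_q` of the last mode `q` of a switching sequence. -/
def lastC (l : List (Q × ℝ≥0)) : (Fin n → ℝ) →L[ℝ] (Fin p → ℝ) :=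
  l.getLast?.elim 0 fun c => mulVecCLM (S.C c.1)

/-- The output at the end of a switching sequence with zero input, as a linear function of the
initial state. These are the state kernels of the system. -/
def response (l : List (Q × ℝ≥0)) : (Fin n → ℝ) →L[ℝ] (Fin p → ℝ) := S.lastC l ∘L S.flow l

/-- The input kernels of the system: the response to the state `B_q a`, where `q` is the first mode
of the switching sequence and `a` the value of the input. -/
def inputKernel : List (Q × ℝ≥0) → (Fin m → ℝ) →ₗ[ℝ] (Fin p → ℝ)
  | [] => 0
  | (q, t) :: l => (S.response ((q, t) :: l)).toLinearMap ∘ₗ (S.B q).mulVecLin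

theorem flow_append (l l' : List (Q × ℝ≥0)) : S.flow (l ++ l') = S.flow l' * S.flow l := by
  induction l with
  | nil => simp [flow]
  | cons c l ih => simp only [List.cons_append, flow, ih, mul_assoc]

theorem lastC_eq {l : List (Q × ℝ≥0)} (hl : l ≠ []) :
    S.lastC l = mulVecCLM (S.C (l.getLast hl).1) := by
  simp [lastC, List.getLast?_eq_some_getLast hl]

theorem lastC_append_cons (l l' : List (Q × ℝ≥0)) (c : Q × ℝ≥0) :
    S.lastC (l ++ c :: l') = S.lastC (c :: l') := by
  simp only [lastC, List.getLast?_append, List.getLast?_cons, Option.some_or]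

theorem lastC_concat (l : List (Q × ℝ≥0)) (c : Q × ℝ≥0) :
    S.lastC (l ++ [c]) = mulVecCLM (S.C c.1) := by
  simp [lastC]

theorem lastC_cons_cons (c d : Q × ℝ≥0) (l : List (Q × ℝ≥0)) :
    S.lastC (c :: d :: l) = S.lastC (d :: l) :=
  S.lastC_append_cons [c] l d

theorem lastC_cons_time (q : Q) (t t' : ℝ≥0) (l : List (Q × ℝ≥0)) :
    S.lastC ((q, t) :: l) = S.lastC ((q, t') :: l) := by
  cases l with
  | nil => rfl
  | cons d l => rw [lastC_cons_cons, lastC_cons_cons]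

theorem response_concat_zero (l : List (Q × ℝ≥0)) (q : Q) (x : Fin n → ℝ) :
    S.response (l ++ [(q, 0)]) x = S.C q *ᵥ S.flow l x := by
  simp [response, lastC_concat, flow_append, flow]

theorem response_merge (w v : List (Q × ℝ≥0)) (q : Q) (t t' : ℝ≥0) :
    S.response (w ++ (q, t) :: (q, t') :: v) = S.response (w ++ (q, t + t') :: v) := by
  simp only [response, lastC_append_cons, flow_append, flow]
  rw [lastC_cons_cons, S.lastC_cons_time q t' (t + t'), NNReal.coe_add, add_comm (t : ℝ),
    expFlow_add]
  simp only [mul_assoc]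

theorem response_drop_zero (v w : List (Q × ℝ≥0)) (q : Q) (hw : w ≠ []) :
    S.response (v ++ (q, 0) :: w) = S.response (v ++ w) := by
  obtain ⟨d, w, rfl⟩ := List.exists_cons_of_ne_nil hw
  simp only [response, lastC_append_cons, flow_append]
  rw [lastC_cons_cons, flow]
  simp

theorem analyticInTimes_flow : AnalyticInTimes S.flow := by
  intro k q
  induction k with
  | zero => simpa only [List.ofFn_zero] using analyticOn_const
  | succ k ih =>
    have hproj : ∀ i, AnalyticOn ℝ (fun t : Fin (k + 1) → ℝ => t i) {t | ∀ i, 0 ≤ t i} := fun i =>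
      (ContinuousLinearMap.proj (R := ℝ) (φ := fun _ : Fin (k + 1) => ℝ) i).analyticOn _
    have htail := (ih fun i => q i.succ).comp
      (g := fun (t : Fin (k + 1) → ℝ) i => t (Fin.succ i)) (AnalyticOn.pi fun i => hproj i.succ)
      fun t ht i => ht i.succ
    have hhead := AnalyticOn.comp (s := univ)
      (fun t _ => (analyticAt_expFlow (mulVecCLM (S.A (q 0))) t).analyticWithinAt) (hproj 0)
      (mapsTo_univ _ _)
    refine (htail.mul hhead).congr fun t ht => ?_
    simp only [List.ofFn_succ, flow, Real.coe_toNNReal _ (ht 0)]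
    rfl

theorem analyticInTimes_response (x : Fin n → ℝ) : AnalyticInTimes fun l => S.response l x := by
  intro k q
  cases k with
  | zero => simpa only [List.ofFn_zero] using analyticOn_const
  | succ k =>
    let c := mulVecCLM (S.C (q (Fin.last k))) ∘L ContinuousLinearMap.apply ℝ (Fin n → ℝ) x
    refine ((c.analyticOn univ).comp (S.analyticInTimes_flow _ q) (mapsTo_univ _ _)).congr
      fun t _ => ?_
    have hC : S.lastC (List.ofFn fun i => (q i, (t i).toNNReal)) =
        mulVecCLM (S.C (q (Fin.last k))) := by
      rw [List.ofFn_succ', List.concat_eq_append, lastC_concat]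
    simp only [response, hC]
    rfl

theorem analyticInTimes_inputKernel (a : Fin m → ℝ) :
    AnalyticInTimes fun l => S.inputKernel l a := by
  intro k q
  cases k with
  | zero => simpa only [List.ofFn_zero] using analyticOn_const
  | succ k =>
    refine (S.analyticInTimes_response (S.B (q 0) *ᵥ a) (k + 1) q).congr fun t _ => ?_
    simp only [List.ofFn_succ, inputKernel]
    rfl

theorem lastC_flow_solution (u : PC m) (τ : ℝ≥0) (x : Fin n → ℝ) (q : Q) (t : ℝ≥0)
    (l : List (Q × ℝ≥0)) :
    S.lastC ((q, t) :: l) (S.flow l (solution (S.A q) (S.B q) (u.shift τ) x t)) =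
      S.response ((q, t) :: l) x +
        ∫ s in (0 : ℝ)..t, S.inputKernel ((q, ((t : ℝ) - s).toNNReal) :: l) (u.shift τ s) := by
  rw [solution_eq_duhamel _ _ _ _ _ t.coe_nonneg, duhamel, map_add, map_add,
    ← ContinuousLinearMap.comp_apply (S.lastC _) (S.flow l) (intervalIntegral _ _ _ _),
    ← ContinuousLinearMap.intervalIntegral_comp_comm _ (intervalIntegrable_expFlow_sub_apply _
      (intervalIntegrable_mulVec_shift (S.B q) u τ t.coe_nonneg) t)]
  congr 1
  refine intervalIntegral.integral_congr fun s hs => ?_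
  rw [uIcc_of_le t.coe_nonneg] at hs
  simp only [inputKernel, response, S.lastC_cons_time q ((t : ℝ) - s).toNNReal t, flow,
    Real.coe_toNNReal _ (sub_nonneg.2 hs.2)]
  rfl

theorem lastC_stateFrom (u : PC m) (τ : ℝ≥0) (x : Fin n → ℝ) {l : List (Q × ℝ≥0)} (hl : l ≠ []) :
    S.lastC l (S.stateFrom u τ x l) = S.response l x + inputTerm S.inputKernel u.1 τ l := by
  induction l generalizing τ x with
  | nil => exact absurd rfl hl
  | cons c l ih =>
    obtain ⟨q, t⟩ := c
    set y := solution (S.A q) (S.B q) (u.shift τ) x (t : ℝ)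
    have hstep : S.lastC ((q, t) :: l) (S.stateFrom u τ x ((q, t) :: l)) =
        S.lastC ((q, t) :: l) (S.flow l y) + inputTerm S.inputKernel u.1 (τ + t) l := by
      cases l with
      | nil => exact (add_zero _).symm
      | cons d l =>
        rw [lastC_cons_cons]
        exact ih (τ + t) y (List.cons_ne_nil _ _)
    rw [hstep, lastC_flow_solution, inputTerm, add_assoc]
    rfl

theorem isRepresentedBy_output (x : Fin n → ℝ) :
    IsRepresentedBy (S.output x) (fun l => S.response l x) S.inputKernel where
  isKernel :=
    { analytic := S.analyticInTimes_response x
      merge := fun w v q t t' => by rw [S.response_merge]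
      drop_zero := fun v w q hw => by rw [S.response_drop_zero v w q hw] }
  analytic := S.analyticInTimes_inputKernel
  merge w v q t t' := by
    have h := S.response_merge w v q t t'
    cases w with
    | nil => simp only [List.nil_append, inputKernel] at h ⊢; rw [h]
    | cons c w => simp only [List.cons_append, inputKernel] at h ⊢; rw [h]
  drop_zero v w q hw hv := by
    have h := S.response_drop_zero v w q hw
    obtain ⟨c, v, rfl⟩ := List.exists_cons_of_ne_nil hv
    simp only [List.cons_append, inputKernel] at h ⊢
    rw [h]
  eq u w := by
    rw [← S.lastC_stateFrom u 0 x w.2, S.lastC_eq w.2]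
    rfl

theorem runWord_append (w v : List Q) (x : Fin n → ℝ) :
    S.runWord (w ++ v) x = S.runWord v (S.runWord w x) :=
  List.foldl_append

/-- `runWord` as a linear map. -/
def runWordLin : List Q → (Fin n → ℝ) →ₗ[ℝ] (Fin n → ℝ)
  | [] => LinearMap.id
  | q :: w => runWordLin w ∘ₗ (S.A q).mulVecLin

@[simp]
theorem runWordLin_apply (w : List Q) (x : Fin n → ℝ) : S.runWordLin w x = S.runWord w x := by
  induction w generalizing x with
  | nil => rfl
  | cons _ _ ih => exact ih _

theorem mixedDeriv_flow (c : (Fin n → ℝ) →L[ℝ] (Fin p → ℝ)) (w : List Q) (x : Fin n → ℝ) :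
    mixedDeriv (fun l => c (S.flow l x)) w = c (S.runWord w x) := by
  induction w generalizing x with
  | nil => rfl
  | cons q w ih =>
    set L := mulVecCLM (S.A q)
    set c' := c ∘L LinearMap.toContinuousLinearMap (S.runWordLin w) with hc'
    have hderiv := c'.hasFDerivAt.comp_hasDerivAt 0
      ((hasDerivAt_expFlow L 0).clm_apply (hasDerivAt_const 0 x))
    have hinner : ∀ t ∈ Ici (0 : ℝ),
        mixedDeriv (fun l => c (S.flow ((q, t.toNNReal) :: l) x)) w = c' (expFlow L t x) := by
      intro t ht
      have h := ih (expFlow L t x)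
      rw [← S.runWordLin_apply] at h
      refine Eq.trans ?_ h
      simp only [flow, Real.coe_toNNReal t ht]
      rfl
    rw [mixedDeriv, derivWithin_congr hinner (hinner 0 self_mem_Ici)]
    refine (hderiv.hasDerivWithinAt.derivWithin (uniqueDiffOn_Ici 0 0 self_mem_Ici)).trans ?_
    simp only [hc', expFlow_zero, mul_one, map_zero, add_zero]
    exact congrArg c (S.runWordLin_apply (q :: w) x)

theorem markovState_output (x : Fin n → ℝ) (q : Q) (w : List Q) :
    markovState (S.output x) q w = S.C q *ᵥ S.runWord w x := by
  rw [(S.isRepresentedBy_output x).markovState_eq]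
  simp only [response_concat_zero]
  exact S.mixedDeriv_flow (mulVecCLM (S.C q)) w x

theorem markovInput_output (x : Fin n → ℝ) (q q₀ : Q) (j : Fin m) (w : List Q) :
    markovInput (S.output x) q q₀ j w = S.C q *ᵥ S.runWord w ((S.B q₀).col j) := by
  have hG : ∀ l : List (Q × ℝ≥0), S.inputKernel ((q₀, 0) :: (l ++ [(q, 0)])) (Pi.single j 1) =
      mulVecCLM (S.C q) (S.flow l ((S.B q₀).col j)) := by
    intro l
    have h := S.response_drop_zero [] (l ++ [(q, 0)]) q₀ (by simp)
    rw [List.nil_append, List.nil_append] at h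
    rw [inputKernel, h, mulVecCLM_apply, ← S.response_concat_zero]
    simp
  rw [(S.isRepresentedBy_output x).markovInput_eq]
  simp only [hG]
  exact S.mixedDeriv_flow (mulVecCLM (S.C q)) w _

end LSS

/-! ### Dimensions of subspaces and stabilization -/

section Dimension

variable {K E F : Type*} [DivisionRing K] [AddCommGroup E] [Module K E] [AddCommGroup F]
  [Module K F] {X Y : Submodule K E}

/-- The dimension of a subspace as an extended natural number, so that ranks of infinite Hankel
matrices are dimensions. -/
def edim (Y : Submodule K E) : ℕ∞ := Cardinal.toENat (Module.rank K Y)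

theorem edim_mono (h : X ≤ Y) : edim X ≤ edim Y :=
  OrderHomClass.mono Cardinal.toENat (Submodule.rank_mono h)

theorem edim_map_le (g : E →ₗ[K] F) (Y : Submodule K E) : edim (Y.map g) ≤ edim Y := by
  have h := OrderHomClass.mono Cardinal.toENat (lift_rank_map_le g Y)
  rwa [Cardinal.toENat_lift, Cardinal.toENat_lift] at h

theorem edim_ne_top_iff : edim Y ≠ ⊤ ↔ FiniteDimensional K Y := by
  rw [edim, ne_eq, Cardinal.toENat_eq_top, not_le, Module.rank_lt_aleph0_iff]

theorem edim_eq_finrank [FiniteDimensional K Y] : edim Y = Module.finrank K Y := by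
  rw [edim, ← Module.finrank_eq_rank, Cardinal.toENat_nat]

theorem eq_of_le_of_edim_le (h : X ≤ Y) (hY : edim Y ≠ ⊤) (hd : edim Y ≤ edim X) : X = Y := by
  have := edim_ne_top_iff.1 hY
  have := Submodule.finiteDimensional_of_le h
  rw [edim_eq_finrank, edim_eq_finrank, Nat.cast_le] at hd
  exact Submodule.eq_of_le_of_finrank_le h hd

theorem edim_map_of_disjoint_ker {g : E →ₗ[K] F} (h : Disjoint Y g.ker) :
    edim (Y.map g) = edim Y := by
  have hinj := LinearMap.injective_domRestrict_iff.2 h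
  have h1 := congrArg Cardinal.toENat (LinearEquiv.ofInjective _ hinj).lift_rank_eq
  rw [Cardinal.toENat_lift, Cardinal.toENat_lift, LinearMap.range_domRestrict] at h1
  exact h1.symm

theorem disjoint_ker_of_edim_map_eq {g : E →ₗ[K] F} (h : edim (Y.map g) = edim Y)
    (hY : edim Y ≠ ⊤) : Disjoint Y g.ker := by
  have := edim_ne_top_iff.1 hY
  rw [edim_eq_finrank, edim_eq_finrank, Nat.cast_inj] at h
  exact Submodule.disjoint_ker_of_finrank_le g h.ge

end Dimension

theorem isFixedPt_iterate_of_strictMono {P : Type*} [PartialOrder P] {f : P → P}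
    (hf : Monotone f) {x : P} (hx : x ≤ f x) {d : P → ℕ} (hd : StrictMono d) {n k : ℕ}
    (hn : ∀ y, d y ≤ n) (hk : n ≤ k) : Function.IsFixedPt f (f^[k] x) := by
  have hle : ∀ k, f^[k] x ≤ f (f^[k] x) := fun k => by
    rw [← Function.iterate_succ_apply' f]
    exact hf.monotone_iterate_of_le_map hx (Nat.le_succ k)
  have hgrow : ∀ k, Function.IsFixedPt f (f^[k] x) ∨ k ≤ d (f^[k] x) := by
    intro k
    induction k with
    | zero => exact Or.inr (Nat.zero_le _)
    | succ k ih =>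
      rw [Function.iterate_succ_apply']
      rcases (hle k).eq_or_lt with h | h
      · exact Or.inl (by rw [← h]; exact h.symm)
      · refine Or.inr ((ih.resolve_left h.ne').trans_lt (hd h))
  refine (hgrow k).elim id fun h => ?_
  by_contra hne
  exact (((hn _).trans hk).trans h).not_gt (hd ((hle k).lt_of_ne' hne))

theorem isFixedPt_iterate_of_strictAnti {P : Type*} [PartialOrder P] {f : P → P}
    (hf : Monotone f) {x : P} (hx : f x ≤ x) {d : P → ℕ} (hd : StrictAnti d) {n k : ℕ}
    (hn : ∀ y, d y ≤ n) (hk : n ≤ k) : Function.IsFixedPt f (f^[k] x) :=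
  isFixedPt_iterate_of_strictMono (P := Pᵒᵈ) hf.dual hx hd.dual_left hn hk

namespace LSS

variable {Q : Type*} {m p n : ℕ} (S : LSS Q m p n)

theorem runWord_mem_of_map_le {X : Submodule ℝ (Fin n → ℝ)}
    (hX : ∀ q, X.map (S.A q).mulVecLin ≤ X) {x : Fin n → ℝ} (hx : x ∈ X) (w : List Q) :
    S.runWord w x ∈ X := by
  induction w generalizing x with
  | nil => exact hx
  | cons q _ ih => exact ih (hX q (Submodule.mem_map_of_mem hx))

theorem runWord_mem_span {ι : Type*} (x : ι → Fin n → ℝ) {N : ℕ} (hn : n ≤ N + 1) (w : List Q)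
    (i : ι) : S.runWord w (x i) ∈
      Submodule.span ℝ {y | ∃ v : List Q, v.length ≤ N ∧ ∃ i, S.runWord v (x i) = y} := by
  let X (k : ℕ) := Submodule.span ℝ {y | ∃ v : List Q, v.length < k ∧ ∃ i, S.runWord v (x i) = y}
  let f (Y : Submodule ℝ (Fin n → ℝ)) :=
    Submodule.span ℝ (range x) ⊔ ⨆ q, Y.map (S.A q).mulVecLin
  have hf : Monotone f := fun Y Z h =>
    sup_le_sup_left (iSup_mono fun q => Submodule.map_mono h) _
  have hfix : f (f^[N + 1] ⊥) = f^[N + 1] ⊥ :=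
    isFixedPt_iterate_of_strictMono hf bot_le (d := fun Y => Module.finrank ℝ Y)
      (fun _ _ => Submodule.finrank_lt_finrank_of_lt)
      (fun Y => (Submodule.finrank_le Y).trans_eq (Module.finrank_fin_fun ℝ)) hn
  have hstep : ∀ k, f^[k] ⊥ ≤ X k := by
    intro k
    induction k with
    | zero => exact bot_le
    | succ k ih =>
      rw [Function.iterate_succ_apply']
      refine (hf ih).trans (sup_le (Submodule.span_le.2 ?_) (iSup_le fun q => ?_))
      · rintro _ ⟨i, rfl⟩
        exact Submodule.subset_span ⟨[], k.succ_pos, i, rfl⟩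
      · rw [Submodule.map_span, Submodule.span_le]
        rintro _ ⟨_, ⟨v, hv, i, rfl⟩, rfl⟩
        exact Submodule.subset_span ⟨v ++ [q], by simpa using hv, i, S.runWord_append v [q] (x i)⟩
  have hmem : S.runWord w (x i) ∈ f^[N + 1] ⊥ := by
    refine S.runWord_mem_of_map_le (fun q => ?_) ?_ w
    · exact (le_iSup (fun q => Submodule.map (S.A q).mulVecLin _) q).trans
        (le_sup_right.trans hfix.le)
    · exact (le_sup_left.trans hfix.le) (Submodule.subset_span (mem_range_self i))
  refine Submodule.span_mono ?_ (hstep _ hmem)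
  rintro _ ⟨v, hv, i, rfl⟩
  exact ⟨v, Nat.le_of_lt_succ hv, i, rfl⟩

theorem mulVec_runWord_eq_zero {N : ℕ} (hn : n ≤ N + 1) {x : Fin n → ℝ}
    (hx : ∀ (v : List Q) (q : Q), v.length ≤ N → S.C q *ᵥ S.runWord v x = 0) (v : List Q) (q : Q) :
    S.C q *ᵥ S.runWord v x = 0 := by
  let f (X : Submodule ℝ (Fin n → ℝ)) : Submodule ℝ (Fin n → ℝ) :=
    (⨅ q, (S.C q).mulVecLin.ker) ⊓ ⨅ q, X.comap (S.A q).mulVecLin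
  have hmem : ∀ {X y}, y ∈ f X ↔ (∀ q, S.C q *ᵥ y = 0) ∧ ∀ q, S.A q *ᵥ y ∈ X := by
    simp [f, Submodule.mem_iInf]
  have hf : Monotone f := fun Y Z h =>
    inf_le_inf_left _ (iInf_mono fun q => Submodule.comap_mono h)
  have hle (X : Submodule ℝ (Fin n → ℝ)) : Module.finrank ℝ X ≤ n :=
    (Submodule.finrank_le X).trans_eq (Module.finrank_fin_fun ℝ)
  have hfix : f (f^[N + 1] ⊤) = f^[N + 1] ⊤ :=
    isFixedPt_iterate_of_strictAnti hf le_top (d := fun X => n - Module.finrank ℝ X)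
      (fun X Y h => Nat.sub_lt_sub_left
        ((Submodule.finrank_lt_finrank_of_lt h).trans_le (hle Y))
        (Submodule.finrank_lt_finrank_of_lt h))
      (fun _ => Nat.sub_le _ _) hn
  have hstep : ∀ k y, (∀ (v : List Q) (q : Q), v.length < k → S.C q *ᵥ S.runWord v y = 0) →
      y ∈ f^[k] ⊤ := by
    intro k
    induction k with
    | zero => exact fun _ _ => Submodule.mem_top
    | succ k ih =>
      intro y hy
      rw [Function.iterate_succ_apply', hmem]
      exact ⟨fun q => hy [] q k.succ_pos, fun q => ih _ fun v q' hv =>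
        hy (q :: v) q' (Nat.succ_lt_succ hv)⟩
  have hx' := hstep (N + 1) x fun v q hv => hx v q (Nat.le_of_lt_succ hv)
  refine (hmem.1 (hfix.ge (S.runWord_mem_of_map_le (fun q => ?_) hx' v))).1 q
  exact Submodule.map_le_iff_le_comap.2 fun y hy => (hmem.1 (hfix.ge hy)).2 q

end LSS

/-! ### Column spaces of the Hankel matrix -/

theorem exists_comp_eq_of_ker_le {K E F G : Type*} [DivisionRing K] [AddCommGroup E] [Module K E]
    [AddCommGroup F] [Module K F] [AddCommGroup G] [Module K G] {g : E →ₗ[K] F} {g' : E →ₗ[K] G}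
    (hg : Function.Surjective g) (hker : g.ker ≤ g'.ker) : ∃ T : F →ₗ[K] G, T ∘ₗ g = g' := by
  obtain ⟨s, hs⟩ := g.exists_rightInverse_of_surjective (LinearMap.range_eq_top.2 hg)
  refine ⟨g' ∘ₗ s, LinearMap.ext fun x => ?_⟩
  have hx : s (g x) - x ∈ g.ker := by
    rw [LinearMap.mem_ker, map_sub, sub_eq_zero]
    exact LinearMap.congr_fun hs (g x)
  have := hker hx
  rwa [LinearMap.mem_ker, map_sub, sub_eq_zero] at this

section Hankel

variable {Q : Type*} {m p : ℕ}

/-- Restriction of a column of the Hankel matrix to the rows `(v, i)` with `|v| ≤ L`. -/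
def restrictRows (Q : Type*) (p L : ℕ) :
    (List Q × (Q × Fin p) → ℝ) →ₗ[ℝ] (WordLE Q L × (Q × Fin p) → ℝ) :=
  LinearMap.funLeft ℝ ℝ (Prod.map Subtype.val id)

/-- The shift of a column that moves the row `(qv, i)` to `(v, i)`. It maps the column `(w, j)` of
the Hankel matrix to the column `(wq, j)`. -/
def shiftRows (p : ℕ) (q : Q) : (List Q × (Q × Fin p) → ℝ) →ₗ[ℝ] (List Q × (Q × Fin p) → ℝ) :=
  LinearMap.funLeft ℝ ℝ fun vi => (q :: vi.1, vi.2)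

variable (Φ : Set (IOMap Q m p)) (f₀ : Φ)

/-- The span of the (infinite) columns `(w, j)` of the Hankel matrix with `|w| ≤ M`. -/
def colSpan (M : ℕ) : Submodule ℝ (List Q × (Q × Fin p) → ℝ) :=
  Submodule.span ℝ (range fun wj : WordLE Q M × (Φ ⊕ (Q × Fin m)) =>
    (hankel Φ f₀).col (wj.1.1, wj.2))

/-- The column space of the Hankel matrix. -/
def fullColSpan : Submodule ℝ (List Q × (Q × Fin p) → ℝ) :=
  Submodule.span ℝ (range (hankel Φ f₀).col)

theorem col_mem_colSpan {M : ℕ} {w : List Q} (hw : w.length ≤ M) (j : Φ ⊕ (Q × Fin m)) :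
    (hankel Φ f₀).col (w, j) ∈ colSpan Φ f₀ M :=
  Submodule.subset_span ⟨(⟨w, hw⟩, j), rfl⟩

theorem colSpan_mono : Monotone (colSpan Φ f₀) := by
  intro M M' h
  refine Submodule.span_le.2 ?_
  rintro _ ⟨⟨⟨w, hw⟩, j⟩, rfl⟩
  exact col_mem_colSpan Φ f₀ (hw.trans h) j

theorem colSpan_le_fullColSpan (M : ℕ) : colSpan Φ f₀ M ≤ fullColSpan Φ f₀ := by
  refine Submodule.span_mono ?_
  rintro _ ⟨wj, rfl⟩
  exact mem_range_self _

theorem shiftRows_col (q : Q) (w : List Q) (j : Φ ⊕ (Q × Fin m)) :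
    shiftRows p q ((hankel Φ f₀).col (w, j)) = (hankel Φ f₀).col (w ++ [q], j) := by
  funext vi
  rcases j with f | qz <;>
    simp only [shiftRows, LinearMap.funLeft_apply, hankel, Matrix.col_apply, List.append_assoc,
      List.singleton_append]

theorem colSpan_le_comap_shiftRows (M : ℕ) (q : Q) :
    colSpan Φ f₀ M ≤ (colSpan Φ f₀ (M + 1)).comap (shiftRows p q) := by
  refine Submodule.span_le.2 ?_
  rintro _ ⟨⟨⟨w, hw⟩, j⟩, rfl⟩
  rw [SetLike.mem_coe, Submodule.mem_comap, shiftRows_col]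
  exact col_mem_colSpan Φ f₀ (by simpa using hw) j

theorem col_mem_colSpan_succ {M k : ℕ} {j : Φ ⊕ (Q × Fin m)}
    (hcol : ∀ v : List Q, v.length < k → (hankel Φ f₀).col (v, j) ∈ colSpan Φ f₀ M) {w : List Q}
    (hw : w.length ≤ k) : (hankel Φ f₀).col (w, j) ∈ colSpan Φ f₀ (M + 1) := by
  rcases w.eq_nil_or_concat' with rfl | ⟨v, q, rfl⟩
  · exact col_mem_colSpan Φ f₀ (Nat.zero_le _) j
  · rw [← shiftRows_col]
    exact colSpan_le_comap_shiftRows Φ f₀ M q (hcol v (by simpa using hw))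

theorem map_restrictRows_colSpan (L M : ℕ) :
    (colSpan Φ f₀ M).map (restrictRows Q p L) =
      Submodule.span ℝ (range (subHankel Φ f₀ L M).col) := by
  rw [colSpan, Submodule.map_span, ← range_comp]
  rfl

theorem eRank_subHankel (L M : ℕ) :
    (subHankel Φ f₀ L M).eRank = edim ((colSpan Φ f₀ M).map (restrictRows Q p L)) := by
  rw [map_restrictRows_colSpan]
  rfl

theorem eRank_subHankel_mono {L L' M M' : ℕ} (hL : L ≤ L') (hM : M ≤ M') :
    (subHankel Φ f₀ L M).eRank ≤ (subHankel Φ f₀ L' M').eRank := by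
  let r : WordLE Q L × (Q × Fin p) → WordLE Q L' × (Q × Fin p) :=
    Prod.map (fun v => ⟨v.1, v.2.trans hL⟩) id
  let c : WordLE Q M × (Φ ⊕ (Q × Fin m)) → WordLE Q M' × (Φ ⊕ (Q × Fin m)) :=
    Prod.map (fun w => ⟨w.1, w.2.trans hM⟩) id
  exact (subHankel Φ f₀ L' M').eRank_submatrix_le r c

theorem eRank_subHankel_le (L M : ℕ) : (subHankel Φ f₀ L M).eRank ≤ (hankel Φ f₀).eRank :=
  Matrix.eRank_submatrix_le _ _ _

/-- Truncation of the columns `(w, j)`, `|w| ≤ N + 1`, of the Hankel matrix to columns of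
`H_{Φ,N,N+1}`. -/
def truncation (N : ℕ) : colSpan Φ f₀ (N + 1) →ₗ[ℝ] colSpace Φ f₀ N :=
  (restrictRows Q p N).restrict (Submodule.map_le_iff_le_comap.1
    (map_restrictRows_colSpan Φ f₀ N (N + 1)).le)

/-- The truncation of the columns `(w, j)` with `|w| ≤ N`. -/
def truncationLE (N : ℕ) : colSpan Φ f₀ N →ₗ[ℝ] colSpace Φ f₀ N :=
  truncation Φ f₀ N ∘ₗ Submodule.inclusion (colSpan_mono Φ f₀ (Nat.le_succ N))

/-- The truncation of the shifted columns `(wq, j)` with `|w| ≤ N`. -/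
def truncationShift (N : ℕ) (q : Q) : colSpan Φ f₀ N →ₗ[ℝ] colSpace Φ f₀ N :=
  truncation Φ f₀ N ∘ₗ (shiftRows p q).restrict (colSpan_le_comap_shiftRows Φ f₀ N q)

theorem truncationShift_col {N : ℕ} (q : Q) {w : List Q} (hw : w.length ≤ N)
    (j : Φ ⊕ (Q × Fin m)) :
    truncationShift Φ f₀ N q ⟨_, col_mem_colSpan Φ f₀ hw j⟩ =
      column Φ f₀ N ⟨w ++ [q], by simpa using hw⟩ j :=
  Subtype.ext (congrArg (restrictRows Q p N) (shiftRows_col Φ f₀ q w j))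

variable {Φ f₀}

theorem colSpan_hom_ext {E : Type*} [AddCommGroup E] [Module ℝ E] {M : ℕ}
    {g g' : colSpan Φ f₀ M →ₗ[ℝ] E}
    (h : ∀ (w : WordLE Q M) j, g ⟨_, col_mem_colSpan Φ f₀ w.2 j⟩ =
      g' ⟨_, col_mem_colSpan Φ f₀ w.2 j⟩) : g = g' := by
  refine LinearMap.ext_on Submodule.span_span_coe_preimage ?_
  rintro ⟨_, _⟩ ⟨⟨w, j⟩, rfl⟩
  exact h w j

theorem colSpace_hom_ext {E : Type*} [AddCommGroup E] [Module ℝ E] {N : ℕ}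
    {g g' : colSpace Φ f₀ N →ₗ[ℝ] E}
    (h : ∀ w j, g (column Φ f₀ N w j) = g' (column Φ f₀ N w j)) : g = g' := by
  refine LinearMap.ext_on Submodule.span_span_coe_preimage ?_
  rintro ⟨_, _⟩ ⟨⟨w, j⟩, rfl⟩
  exact h w j

namespace RankCondition

variable {N : ℕ} [hfin : FiniteDimensional ℝ (colSpace Φ f₀ N)]

theorem surjective_truncationLE (h : RankCondition Φ f₀ N) :
    Function.Surjective (truncationLE Φ f₀ N) := by
  have heq : (colSpan Φ f₀ N).map (restrictRows Q p N) = colSpace Φ f₀ N := by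
    refine eq_of_le_of_edim_le ?_ (edim_ne_top_iff.2 hfin) ?_
    · exact (Submodule.map_mono (colSpan_mono Φ f₀ N.le_succ)).trans_eq
        (map_restrictRows_colSpan Φ f₀ N (N + 1))
    · rw [← eRank_subHankel]
      exact (h.1.trans h.2).ge
  rintro ⟨y, hy⟩
  obtain ⟨x, hx, rfl⟩ := heq.ge hy
  exact ⟨⟨x, hx⟩, rfl⟩

theorem restrictRows_succ_eq_zero (h : RankCondition Φ f₀ N) {x : List Q × (Q × Fin p) → ℝ}
    (hx : x ∈ colSpan Φ f₀ N) (h0 : restrictRows Q p N x = 0) :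
    restrictRows Q p (N + 1) x = 0 := by
  let g : (WordLE Q (N + 1) × (Q × Fin p) → ℝ) →ₗ[ℝ] (WordLE Q N × (Q × Fin p) → ℝ) :=
    LinearMap.funLeft ℝ ℝ (Prod.map (fun w => ⟨w.1, w.2.trans (Nat.le_succ N)⟩) id)
  have hg : edim (((colSpan Φ f₀ N).map (restrictRows Q p (N + 1))).map g) =
      edim ((colSpan Φ f₀ N).map (restrictRows Q p (N + 1))) := by
    rw [← Submodule.map_comp, ← eRank_subHankel]
    exact (eRank_subHankel Φ f₀ N N).symm.trans h.1
  have hne : edim ((colSpan Φ f₀ N).map (restrictRows Q p (N + 1))) ≠ ⊤ := by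
    rw [← eRank_subHankel, h.2]
    exact edim_ne_top_iff.2 hfin
  exact LinearMap.disjoint_ker.1 (disjoint_ker_of_edim_map_eq hg hne) _
    (Submodule.mem_map_of_mem hx) h0

theorem exists_shift (h : RankCondition Φ f₀ N) (q : Q) :
    ∃ T : colSpace Φ f₀ N →ₗ[ℝ] colSpace Φ f₀ N,
      T ∘ₗ truncationLE Φ f₀ N = truncationShift Φ f₀ N q := by
  refine exists_comp_eq_of_ker_le h.surjective_truncationLE fun x hx => ?_
  have h0 := h.restrictRows_succ_eq_zero x.2 (congrArg Subtype.val hx)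
  exact Subtype.ext (funext fun vi =>
    congrFun h0 (⟨q :: vi.1.1, Nat.succ_le_succ vi.1.2⟩, vi.2))

end RankCondition

theorem rankCondition_of_eRank_eq {N : ℕ} (h : (subHankel Φ f₀ N N).eRank = (hankel Φ f₀).eRank) :
    RankCondition Φ f₀ N := by
  have hsq : ∀ L M, N ≤ L → N ≤ M → (subHankel Φ f₀ L M).eRank = (hankel Φ f₀).eRank :=
    fun L M hL hM => (eRank_subHankel_le Φ f₀ L M).antisymm
      (h.ge.trans (eRank_subHankel_mono Φ f₀ hL hM))
  have hN := Nat.le_succ N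
  exact ⟨h.trans (hsq _ _ hN le_rfl).symm, (hsq _ _ hN le_rfl).trans (hsq _ _ le_rfl hN).symm⟩

theorem colSpan_eq_fullColSpan_of_eRank_eq {N : ℕ} (hfin : (hankel Φ f₀).eRank ≠ ⊤)
    (h : (subHankel Φ f₀ N N).eRank = (hankel Φ f₀).eRank) :
    colSpan Φ f₀ N = fullColSpan Φ f₀ := by
  refine eq_of_le_of_edim_le (colSpan_le_fullColSpan Φ f₀ N) hfin (h.ge.trans ?_)
  rw [eRank_subHankel]
  exact edim_map_le _ _

end Hankel

/-! ### The output of the column-shift algorithm -/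

namespace LSS

variable {Q : Type*} {m p n : ℕ} (S : LSS Q m p n)

/-- The system `S` with the output `C_q x` replaced by `g x` in every mode. -/
def withOutput (g : (Fin n → ℝ) →ₗ[ℝ] ℝ) : LSS Q m 1 n :=
  ⟨S.A, S.B, fun _ => LinearMap.toMatrix' (LinearMap.pi fun _ => g)⟩

theorem withOutput_C_mulVec (g : (Fin n → ℝ) →ₗ[ℝ] ℝ) (q : Q) (x : Fin n → ℝ) :
    (S.withOutput g).C q *ᵥ x = fun _ => g x :=
  LinearMap.toMatrix'_mulVec _ _

theorem stateFrom_withOutput (g : (Fin n → ℝ) →ₗ[ℝ] ℝ) (u : PC m) (l : List (Q × ℝ≥0))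
    (τ : ℝ≥0) (x : Fin n → ℝ) :
    (S.withOutput g).stateFrom u τ x l = S.stateFrom u τ x l := by
  induction l generalizing τ x with
  | nil => rfl
  | cons _ _ ih => exact ih _ _

variable {S} {g : (Fin n → ℝ) →ₗ[ℝ] ℝ} {x : Fin n → ℝ}

theorem output_withOutput_eq_zero (hg : ∀ u w, g (S.state x u w) = 0) :
    (S.withOutput g).output x = fun _ _ => 0 := by
  funext u w
  rw [output, withOutput_C_mulVec, state, stateFrom_withOutput]
  exact funext fun _ => hg u w

variable [Nonempty Q]

theorem functional_runWord_eq_zero (hg : ∀ u w, g (S.state x u w) = 0) (w : List Q) :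
    g (S.runWord w x) = 0 := by
  obtain ⟨q⟩ := ‹Nonempty Q›
  have h := (S.withOutput g).markovState_output x q w
  rw [output_withOutput_eq_zero hg, withOutput_C_mulVec] at h
  simp only [markovState, ioDeriv, mixedDeriv_zero] at h
  exact (congrFun h 0).symm

theorem functional_runWord_col_eq_zero (hg : ∀ u w, g (S.state x u w) = 0) (w : List Q) (q₀ : Q)
    (j : Fin m) : g (S.runWord w ((S.B q₀).col j)) = 0 := by
  obtain ⟨q⟩ := ‹Nonempty Q›
  have h := (S.withOutput g).markovInput_output x q q₀ j w
  rw [output_withOutput_eq_zero hg, withOutput_C_mulVec] at h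
  simp only [markovInput, ioDeriv, mixedDeriv_zero, sub_zero] at h
  exact (congrFun h 0).symm

end LSS

namespace Realization

variable {Q : Type*} {m p n N : ℕ} {Φ : Set (IOMap Q m p)} {f₀ : Φ}
  {iso : colSpace Φ f₀ N ≃ₗ[ℝ] (Fin n → ℝ)} {R : Realization Φ n}

theorem exists_isAlgorithmOutput (hr : RankCondition Φ f₀ N)
    (iso : colSpace Φ f₀ N ≃ₗ[ℝ] (Fin n → ℝ)) :
    ∃ R : Realization Φ n, R.IsAlgorithmOutput f₀ N iso := by
  have := Module.Finite.equiv iso.symm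
  choose T hT using hr.exists_shift
  let c (q : Q) : colSpace Φ f₀ N →ₗ[ℝ] (Fin p → ℝ) :=
    LinearMap.funLeft ℝ ℝ (fun r => (⟨[], by simp⟩, (q, r))) ∘ₗ (colSpace Φ f₀ N).subtype
  refine ⟨⟨⟨fun q => LinearMap.toMatrix' (iso.toLinearMap ∘ₗ T q ∘ₗ iso.symm.toLinearMap),
    fun q => Matrix.of fun i z => iso (column Φ f₀ N ⟨[], by simp⟩ (Sum.inr (q, z))) i,
    fun q => LinearMap.toMatrix' (c q ∘ₗ iso.symm.toLinearMap)⟩,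
    fun f => iso (column Φ f₀ N ⟨[], by simp⟩ (Sum.inl f))⟩, ?_⟩
  refine ⟨fun q z => rfl, fun q w j r => ?_, fun q w j => ?_, fun f => rfl⟩
  · simp only [LinearMap.toMatrix'_mulVec, LinearMap.comp_apply, LinearEquiv.coe_coe,
      LinearEquiv.symm_apply_apply]
    rfl
  · simp only [LinearMap.toMatrix'_mulVec, LinearMap.comp_apply, LinearEquiv.coe_coe,
      LinearEquiv.symm_apply_apply]
    rw [← truncationShift_col Φ f₀ q w.2 j, ← hT q]
    rfl

/-- The states generating the reachable space: `μ(f)` for `f ∈ Φ`, and the columns `B_q e_j`. -/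
def initial (R : Realization Φ n) : Φ ⊕ (Q × Fin m) → Fin n → ℝ
  | Sum.inl f => R.μ f
  | Sum.inr qz => (R.sys.B qz.1).col qz.2

theorem isPartial_of_hankel_eq (hΦ : HasGeneralizedKernelRepresentation Φ) {k : ℕ}
    (h : ∀ (w : List Q), w.length ≤ k → ∀ q r j,
      (R.sys.C q *ᵥ R.sys.runWord w (R.initial j)) r = hankel Φ f₀ ([], (q, r)) (w, j)) :
    R.IsPartial k := by
  intro f q w hw
  refine ⟨fun q₀ j => funext fun r => ?_, funext fun r => ?_⟩
  · simpa only [hankel, initial, List.append_nil, hΦ.markovInput_eq f₀ f] using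
      (h w hw q r (Sum.inr (q₀, j))).symm
  · simpa only [hankel, initial, List.append_nil] using (h w hw q r (Sum.inl f)).symm

theorem realizes_of_forall_isPartial (hΦ : HasGeneralizedKernelRepresentation Φ)
    (h : ∀ k, R.IsPartial k) : R.Realizes := by
  obtain ⟨G, hG⟩ := hΦ.exists_isRepresentedBy
  intro f u w
  obtain ⟨K, hK⟩ := hG f
  have hf : R.sys.output (R.μ f) = f.1 :=
    (R.sys.isRepresentedBy_output (R.μ f)).eq_of_markov_eq hK
      (fun q w => by rw [LSS.markovState_output, (h w.length f q w le_rfl).2])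
      (fun q q₀ j w => by rw [LSS.markovInput_output, (h w.length f q w le_rfl).1])
  rw [hf]

namespace IsAlgorithmOutput

theorem initial_eq (h : R.IsAlgorithmOutput f₀ N iso) (j : Φ ⊕ (Q × Fin m)) :
    R.initial j = iso (column Φ f₀ N ⟨[], by simp⟩ j) := by
  rcases j with f | ⟨q, z⟩
  · exact h.μ_eq f
  · exact h.B_eq q z

theorem C_apply (h : R.IsAlgorithmOutput f₀ N iso) (q : Q) (r : Fin p) (y : colSpace Φ f₀ N) :
    (R.sys.C q *ᵥ iso y) r = y.1 (⟨[], by simp⟩, (q, r)) := by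
  have hcomp : LinearMap.proj r ∘ₗ (R.sys.C q).mulVecLin ∘ₗ iso.toLinearMap =
      LinearMap.proj (R := ℝ) (φ := fun _ => ℝ) (⟨[], by simp⟩, (q, r)) ∘ₗ
        (colSpace Φ f₀ N).subtype :=
    colSpace_hom_ext fun w j => h.C_eq q w j r
  exact LinearMap.congr_fun hcomp y

theorem A_apply (h : R.IsAlgorithmOutput f₀ N iso) (q : Q) (x : colSpan Φ f₀ N) :
    R.sys.A q *ᵥ iso (truncationLE Φ f₀ N x) = iso (truncationShift Φ f₀ N q x) := by
  have hcomp : (R.sys.A q).mulVecLin ∘ₗ iso.toLinearMap ∘ₗ truncationLE Φ f₀ N =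
      iso.toLinearMap ∘ₗ truncationShift Φ f₀ N q := by
    refine colSpan_hom_ext fun w j => ?_
    rw [LinearMap.comp_apply iso.toLinearMap, truncationShift_col Φ f₀ q w.2 j]
    exact iso.symm_apply_eq.1 (h.A_eq q w j)
  exact LinearMap.congr_fun hcomp x

theorem eq_of_rankCondition (hr : RankCondition Φ f₀ N) (h : R.IsAlgorithmOutput f₀ N iso)
    {R' : Realization Φ n} (h' : R'.IsAlgorithmOutput f₀ N iso) : R' = R := by
  have := Module.Finite.equiv iso.symm
  have hA : R'.sys.A = R.sys.A := by
    refine funext fun q => Matrix.mulVec_injective (funext fun z => ?_)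
    obtain ⟨x, rfl⟩ := (iso.surjective.comp hr.surjective_truncationLE) z
    exact (h'.A_apply q x).trans (h.A_apply q x).symm
  have hB : R'.sys.B = R.sys.B := funext fun q => Matrix.ext fun i z =>
    congrFun ((h'.B_eq q z).trans (h.B_eq q z).symm) i
  have hC : R'.sys.C = R.sys.C := by
    refine funext fun q => Matrix.mulVec_injective (funext₂ fun z r => ?_)
    obtain ⟨y, rfl⟩ := iso.surjective z
    exact (h'.C_apply q r y).trans (h.C_apply q r y).symm
  have hμ : R'.μ = R.μ := funext fun f => (h'.μ_eq f).trans (h.μ_eq f).symm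
  obtain ⟨⟨A, B, C⟩, μ⟩ := R
  obtain ⟨⟨A', B', C'⟩, μ'⟩ := R'
  simp only at hA hB hC hμ
  subst hA hB hC hμ
  rfl

theorem runWord_initial (h : R.IsAlgorithmOutput f₀ N iso) {k : ℕ} {j : Φ ⊕ (Q × Fin m)}
    (hcol : ∀ v : List Q, v.length < k → (hankel Φ f₀).col (v, j) ∈ colSpan Φ f₀ N) {w : List Q}
    (hw : w.length ≤ k) : R.sys.runWord w (R.initial j) =
      iso (truncation Φ f₀ N ⟨_, col_mem_colSpan_succ Φ f₀ hcol hw⟩) := by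
  induction w using List.reverseRecOn with
  | nil => exact h.initial_eq j
  | append_singleton w q ih =>
    have hx := hcol w (by simpa using hw)
    rw [LSS.runWord_append, ih (by grind)]
    refine (h.A_apply q ⟨_, hx⟩).trans (congrArg iso (Subtype.ext ?_))
    exact congrArg (restrictRows Q p N) (shiftRows_col Φ f₀ q w j)

theorem runWord_initial_eq_column (h : R.IsAlgorithmOutput f₀ N iso) (w : WordLE Q (N + 1))
    (j : Φ ⊕ (Q × Fin m)) : R.sys.runWord w.1 (R.initial j) = iso (column Φ f₀ N w j) :=
  h.runWord_initial (fun _ hv => col_mem_colSpan Φ f₀ (Nat.le_of_lt_succ hv) j) w.2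

theorem C_mulVec_runWord (h : R.IsAlgorithmOutput f₀ N iso) (hr : RankCondition Φ f₀ N)
    {v : List Q} (hv : v.length ≤ N) (q : Q) (r : Fin p) (y : colSpace Φ f₀ N) :
    (R.sys.C q *ᵥ R.sys.runWord v (iso y)) r = y.1 (⟨v, hv⟩, (q, r)) := by
  have := Module.Finite.equiv iso.symm
  induction v generalizing y with
  | nil => exact h.C_apply q r y
  | cons q' v ih =>
    obtain ⟨x, rfl⟩ := hr.surjective_truncationLE y
    change (R.sys.C q *ᵥ R.sys.runWord v (R.sys.A q' *ᵥ iso (truncationLE Φ f₀ N x))) r = _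
    rw [h.A_apply, ih (Nat.le_of_succ_le hv)]
    rfl

theorem isPartial_of_col_mem (h : R.IsAlgorithmOutput f₀ N iso) (hr : RankCondition Φ f₀ N)
    (hΦ : HasGeneralizedKernelRepresentation Φ) {k : ℕ} (hcol : ∀ (v : List Q) j, v.length < k →
      (hankel Φ f₀).col (v, j) ∈ colSpan Φ f₀ N) : R.IsPartial (k + N) := by
  refine isPartial_of_hankel_eq (f₀ := f₀) hΦ fun w hw q r j => ?_
  have htake : (w.take k).length ≤ k := List.length_take_le k w
  have hdrop : (w.drop k).length ≤ N := by grind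
  calc (R.sys.C q *ᵥ R.sys.runWord w (R.initial j)) r
    _ = (R.sys.C q *ᵥ R.sys.runWord (w.drop k) (R.sys.runWord (w.take k) (R.initial j))) r := by
      rw [← LSS.runWord_append, List.take_append_drop]
    _ = hankel Φ f₀ (w.drop k, (q, r)) (w.take k, j) := by
      rw [h.runWord_initial (fun v => hcol v j) htake, h.C_mulVec_runWord hr hdrop]
      rfl
    _ = hankel Φ f₀ ([], (q, r)) (w, j) := by
      rcases j with f | qz <;>
        simp only [hankel, List.take_append_drop, List.append_nil]

theorem isPartial (h : R.IsAlgorithmOutput f₀ N iso) (hr : RankCondition Φ f₀ N)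
    (hΦ : HasGeneralizedKernelRepresentation Φ) : R.IsPartial (2 * N + 1) := by
  have hN : 2 * N + 1 = N + 1 + N := by ring
  exact hN ▸ h.isPartial_of_col_mem hr hΦ fun v j hv =>
    col_mem_colSpan Φ f₀ (Nat.le_of_lt_succ hv) j

theorem observable (h : R.IsAlgorithmOutput f₀ N iso) (hr : RankCondition Φ f₀ N) :
    R.Observable := by
  intro x₁ x₂ hx
  obtain ⟨y₁, rfl⟩ := iso.surjective x₁
  obtain ⟨y₂, rfl⟩ := iso.surjective x₂
  have hout : R.sys.output (iso y₁) = R.sys.output (iso y₂) := funext₂ hx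
  refine congrArg iso (Subtype.ext (funext fun ⟨⟨v, hv⟩, q, r⟩ => ?_))
  rw [← h.C_mulVec_runWord hr hv, ← h.C_mulVec_runWord hr hv, ← LSS.markovState_output,
    ← LSS.markovState_output, hout]

theorem semiReachable (h : R.IsAlgorithmOutput f₀ N iso) : R.SemiReachable := by
  rcases isEmpty_or_nonempty Q with hQ | hQ
  · refine Submodule.eq_top_iff'.2 fun x => ?_
    have hx : x = 0 := iso.symm.injective (Subtype.ext (funext fun vi => isEmptyElim vi.2.1))
    exact hx ▸ Submodule.zero_mem _
  by_contra hne
  obtain ⟨g, hg0, hg⟩ := Submodule.exists_le_ker_of_lt_top _ (lt_top_iff_ne_top.2 hne)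
  have hzero (f : Φ) (u w) : g (R.sys.state (R.μ f) u w) = 0 :=
    hg (Submodule.subset_span ⟨u, w, R.μ f, mem_range_self f, rfl⟩)
  have hcomp : g ∘ₗ iso.toLinearMap = 0 := by
    refine colSpace_hom_ext fun w j => ?_
    change g (iso _) = 0
    rw [← h.runWord_initial_eq_column]
    rcases j with f | ⟨q₀, j⟩
    · exact LSS.functional_runWord_eq_zero (hzero f) w.1
    · exact LSS.functional_runWord_col_eq_zero (hzero f₀) w.1 q₀ j
  refine hg0 (LinearMap.ext fun x => ?_)
  obtain ⟨y, rfl⟩ := iso.surjective x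
  exact LinearMap.congr_fun hcomp y

end IsAlgorithmOutput

end Realization

/-! ### The Hankel matrix of a realizable family -/

namespace LSS

variable {Q : Type*} {m p n : ℕ} (S : LSS Q m p n)

/-- The observability map, sending a state `x` to the family of all `C_q A_v x`. -/
def observations : (Fin n → ℝ) →ₗ[ℝ] (List Q × (Q × Fin p) → ℝ) :=
  LinearMap.pi fun vi => LinearMap.proj vi.2.2 ∘ₗ (S.C vi.2.1).mulVecLin ∘ₗ S.runWordLin vi.1

theorem observations_apply (x : Fin n → ℝ) (v : List Q) (q : Q) (r : Fin p) :
    S.observations x (v, (q, r)) = (S.C q *ᵥ S.runWord v x) r := by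
  simp only [observations, LinearMap.pi_apply, LinearMap.comp_apply, LinearMap.proj_apply,
    Matrix.mulVecLin_apply, runWordLin_apply]

theorem disjoint_range_observations_ker {N : ℕ} (hn : n ≤ N + 1) :
    Disjoint S.observations.range (restrictRows Q p N).ker := by
  refine LinearMap.disjoint_ker.2 ?_
  rintro _ ⟨x, rfl⟩ h0
  have hx := S.mulVec_runWord_eq_zero hn fun v q hv => funext fun r =>
    (S.observations_apply x v q r).symm.trans (congrFun h0 (⟨v, hv⟩, (q, r)))
  exact funext fun ⟨v, q, r⟩ => (S.observations_apply x v q r).trans (congrFun (hx v q) r)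

end LSS

namespace Realization

variable {Q : Type*} {m p n N : ℕ} {Φ : Set (IOMap Q m p)} {f₀ : Φ} {R : Realization Φ n}

namespace Realizes

theorem output_eq (h : R.Realizes) (f : Φ) : R.sys.output (R.μ f) = f.1 :=
  funext₂ (h f)

theorem col_eq (h : R.Realizes) (w : List Q) (j : Φ ⊕ (Q × Fin m)) :
    (hankel Φ f₀).col (w, j) = R.sys.observations (R.sys.runWord w (R.initial j)) := by
  funext ⟨v, q, r⟩
  rw [LSS.observations_apply, ← LSS.runWord_append]
  rcases j with f | ⟨q₀, z⟩
  · simp only [Matrix.col_apply, hankel, initial]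
    rw [← h.output_eq f, LSS.markovState_output]
  · simp only [Matrix.col_apply, hankel, initial]
    rw [← h.output_eq f₀, LSS.markovInput_output]

theorem fullColSpan_le_range (h : R.Realizes) : fullColSpan Φ f₀ ≤ R.sys.observations.range := by
  refine Submodule.span_le.2 ?_
  rintro _ ⟨⟨w, j⟩, rfl⟩
  exact ⟨_, (h.col_eq w j).symm⟩

theorem colSpan_eq_fullColSpan (h : R.Realizes) (hn : n ≤ N + 1) :
    colSpan Φ f₀ N = fullColSpan Φ f₀ := by
  refine (colSpan_le_fullColSpan Φ f₀ N).antisymm (Submodule.span_le.2 ?_)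
  rintro _ ⟨⟨w, j⟩, rfl⟩
  rw [h.col_eq]
  refine (Submodule.span_le (p := (colSpan Φ f₀ N).comap R.sys.observations)).2 ?_
    (R.sys.runWord_mem_span R.initial hn w j)
  rintro _ ⟨v, hv, j, rfl⟩
  rw [SetLike.mem_coe, Submodule.mem_comap, ← h.col_eq]
  exact col_mem_colSpan Φ f₀ hv j

theorem eRank_eq (h : R.Realizes) (hn : n ≤ N + 1) :
    (subHankel Φ f₀ N N).eRank = (hankel Φ f₀).eRank := by
  rw [eRank_subHankel, h.colSpan_eq_fullColSpan hn, edim_map_of_disjoint_ker]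
  · rfl
  · exact (R.sys.disjoint_range_observations_ker hn).mono_left h.fullColSpan_le_range

theorem eRank_hankel_le (h : R.Realizes) : (hankel Φ f₀).eRank ≤ n :=
  calc (hankel Φ f₀).eRank
    _ ≤ edim R.sys.observations.range := edim_mono h.fullColSpan_le_range
    _ ≤ n := by
      rw [edim_eq_finrank, Nat.cast_le]
      exact R.sys.observations.finrank_range_le.trans_eq (Module.finrank_fin_fun ℝ)

end Realizes

namespace IsAlgorithmOutput

variable {iso : colSpace Φ f₀ N ≃ₗ[ℝ] (Fin n → ℝ)}

theorem realizes (h : R.IsAlgorithmOutput f₀ N iso)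
    (hr : (subHankel Φ f₀ N N).eRank = (hankel Φ f₀).eRank)
    (hΦ : HasGeneralizedKernelRepresentation Φ) : R.Realizes := by
  have := Module.Finite.equiv iso.symm
  have hfin : (hankel Φ f₀).eRank ≠ ⊤ := by
    rw [← hr]
    exact ne_top_of_le_ne_top (edim_ne_top_iff.2 this)
      (eRank_subHankel_mono Φ f₀ le_rfl N.le_succ)
  have hfull := colSpan_eq_fullColSpan_of_eRank_eq hfin hr
  refine realizes_of_forall_isPartial hΦ fun k f q w hw => ?_
  refine h.isPartial_of_col_mem (rankCondition_of_eRank_eq hr) hΦ (k := k) (fun v j _ => ?_)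
    f q w (hw.trans (Nat.le_add_right k N))
  exact hfull ▸ Submodule.subset_span (mem_range_self _)

theorem isMinimal (h : R.IsAlgorithmOutput f₀ N iso)
    (hr : (subHankel Φ f₀ N N).eRank = (hankel Φ f₀).eRank)
    (hΦ : HasGeneralizedKernelRepresentation Φ) : R.IsMinimal := by
  refine ⟨h.realizes hr hΦ, fun n' R' hR' => ?_⟩
  have := Module.Finite.equiv iso.symm
  have hn : edim (colSpace Φ f₀ N) = n := by
    rw [edim_eq_finrank, iso.finrank_eq, Module.finrank_fin_fun]
  exact_mod_cast calc (n : ℕ∞)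
    _ = (subHankel Φ f₀ N (N + 1)).eRank := hn.symm
    _ ≤ (hankel Φ f₀).eRank := eRank_subHankel_le Φ f₀ N (N + 1)
    _ ≤ n' := hR'.eRank_hankel_le

end IsAlgorithmOutput

end Realization

theorem eRank_subHankel_ne_top {Q : Type*} [Finite Q] {m p : ℕ} (Φ : Set (IOMap Q m p)) (f₀ : Φ)
    (L M : ℕ) : (subHankel Φ f₀ L M).eRank ≠ ⊤ := by
  have : Finite (WordLE Q L) := (List.finite_length_le Q L).to_subtype
  exact edim_ne_top_iff.2 inferInstance

end SwitchedSystem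

end

open SwitchedSystem in
theorem theorem1_general {Q : Type*} {m p : ℕ} (Φ : Set (IOMap Q m p)) (f₀ : Φ)
    (hΦ : HasGeneralizedKernelRepresentation Φ) (N : ℕ) :
    ((subHankel Φ f₀ N (N + 1)).eRank ≠ ⊤ → RankCondition Φ f₀ N →
      ∃ n : ℕ, (subHankel Φ f₀ N (N + 1)).eRank = n ∧
        Nonempty (colSpace Φ f₀ N ≃ₗ[ℝ] (Fin n → ℝ)) ∧
        ∀ iso : colSpace Φ f₀ N ≃ₗ[ℝ] (Fin n → ℝ),
          ∃ R : Realization Φ n, R.IsAlgorithmOutput f₀ N iso ∧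
            (∀ R' : Realization Φ n, R'.IsAlgorithmOutput f₀ N iso → R' = R) ∧
            R.SemiReachable ∧ R.Observable ∧ R.IsPartial (2 * N + 1)) ∧
    ((subHankel Φ f₀ N N).eRank = (hankel Φ f₀).eRank →
      RankCondition Φ f₀ N ∧
        ∀ (n : ℕ) (iso : colSpace Φ f₀ N ≃ₗ[ℝ] (Fin n → ℝ)) (R : Realization Φ n),
          R.IsAlgorithmOutput f₀ N iso → R.IsMinimal) ∧
    ((∃ (n : ℕ) (R : Realization Φ n), R.Realizes ∧ n ≤ N + 1) →
      (subHankel Φ f₀ N N).eRank = (hankel Φ f₀).eRank) := by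
  refine ⟨fun hfin hr => ?_, fun hr => ⟨rankCondition_of_eRank_eq hr, fun n iso R h =>
    h.isMinimal hr hΦ⟩, fun ⟨n, R, hR, hn⟩ => hR.eRank_eq hn⟩
  have hfd : FiniteDimensional ℝ (colSpace Φ f₀ N) := edim_ne_top_iff.1 hfin
  refine ⟨Module.finrank ℝ (colSpace Φ f₀ N), edim_eq_finrank,
    ⟨(Module.finBasis ℝ (colSpace Φ f₀ N)).equivFun⟩, fun iso => ?_⟩
  obtain ⟨R, h⟩ := Realization.exists_isAlgorithmOutput hr iso
  exact ⟨R, h, fun R' h' => h.eq_of_rankCondition hr h', h.semiReachable, h.observable hr,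
    h.isPartial hr hΦ⟩

open SwitchedSystem in
theorem theorem1 {Q : Type*} [Finite Q] {m p : ℕ} (Φ : Set (IOMap Q m p)) (f₀ : Φ)
    (hΦ : HasGeneralizedKernelRepresentation Φ) (N : ℕ) :
    (RankCondition Φ f₀ N →
      ∃ n : ℕ, (subHankel Φ f₀ N (N + 1)).eRank = n ∧
        Nonempty (colSpace Φ f₀ N ≃ₗ[ℝ] (Fin n → ℝ)) ∧
        ∀ iso : colSpace Φ f₀ N ≃ₗ[ℝ] (Fin n → ℝ),
          ∃ R : Realization Φ n, R.IsAlgorithmOutput f₀ N iso ∧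
            (∀ R' : Realization Φ n, R'.IsAlgorithmOutput f₀ N iso → R' = R) ∧
            R.SemiReachable ∧ R.Observable ∧ R.IsPartial (2 * N + 1)) ∧
    ((subHankel Φ f₀ N N).eRank = (hankel Φ f₀).eRank →
      RankCondition Φ f₀ N ∧
        ∀ (n : ℕ) (iso : colSpace Φ f₀ N ≃ₗ[ℝ] (Fin n → ℝ)) (R : Realization Φ n),
          R.IsAlgorithmOutput f₀ N iso → R.IsMinimal) ∧
    ((∃ (n : ℕ) (R : Realization Φ n), R.Realizes ∧ n ≤ N + 1) →
      (subHankel Φ f₀ N N).eRank = (hankel Φ f₀).eRank) := by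
  have h := theorem1_general Φ f₀ hΦ N
  exact ⟨h.1 (eRank_subHankel_ne_top Φ f₀ N (N + 1)), h.2⟩
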